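/- **Setting.** Let $\mathcal U$ be an index set. For every $n$ let $[n]=N_1\cup N_2$ be a partition into two disjoint sets (depending on $n$), with $N_1\neq\emptyset$ for large $n$ and $|N_1|/n\to 0$, $|N_2|/n\to 1$. For $u\in\mathcal U$ let $V(u)=(v_{p,q}(u))_{p,q\in\{1,2\}}$ be a symmetric real matrix, with $\beta_1(u):=v_{2,1}(u)>0$ and $\beta_2(u):=v_{2,2}(u)\ge 0$, and let $\alpha_1(u),\alpha_2(u)\in\mathbb R$. For every $n$ let $Y(u,n)$, $u\in\mathcal U$, be Hermitian random $n\times n$ matrices such that the real and imaginary parts of the entries $Y_{i,j}(u,n)$ are real (possibly degenerate) Gaussian variables of mean zero, $\mathbb E|Y_{i,j}(u,n)|^2=v_{p,q}(u)/n$ for $(i,j)\in N_p\times N_q$, and the family $\{\mathrm{Re}\,Y_{i,j}(u,n),\mathrm{Im}\,Y_{i,j}(u,n):1\le i\le j\le n,\ u\in\mathcal U\}$ is independent. The Free Meixner Ensemble consists of the matrices $$M(u,n)=Y(u,n)+\alpha_1(u)I_1(n)+\alpha_2(u)I_2(n),$$ where $I_p(n)$ is the diagonal projection onto the span of the basis vectors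 indexed by $N_p$. For $q\in\{1,2\}$ let $\tau_q(n)(A)=\frac1{|N_q|}\sum_{i\in N_q}\mathbb E(A_{i,i})$. **Fock space.** Let $\mathcal H_j$ be the Hilbert space with orthonormal basis $(e_j(u))_{u\in\mathcal U}$, $j=1,2$, and let $\mathcal M=\mathcal M_1\oplus\mathcal M_2$ with $\mathcal M_1=\mathbb C\Omega_1\oplus\bigoplus_{k\ge 0}\mathcal H_2^{\otimes k}\otimes\mathcal H_1$ and $\mathcal M_2=\mathbb C\Omega_2\oplus\bigoplus_{k\ge1}\mathcal H_2^{\otimes k}$, where $\Omega_1,\Omega_2$ are unit vectors; let $\Psi_q(T)=\langle\Omega_q,T\Omega_q\rangle$ (inner product linear in the second argument). Let $\wp_1(u),\wp_2(u)$ be the bounded operators on $\mathcal M$ such that $\wp_1(u)$ sends $\Omega_1$ to $\sqrt{\beta_1(u)}\,e_1(u)$ and the remaining basis vectors to $0$, while $\wp_2(u)\Omega_1=0$, $\wp_2(u)\Omega_2=\sqrt{\beta_2(u)}\,e_2(u)$ and $\wp_2(u)x=\sqrt{\beta_2(u)}\,e_2(u)\otimes x$ for every other basis vector $x$. Put $$\omega(u)=\wp_1(u)+\wp_1(u)^*+\wp_2(u)+\wp_2(u)^*,\qquad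 \gamma(u)=\alpha_1(u)P+\alpha_2(u)(1-P),\qquad y(u)=\omega(u)+\gamma(u),$$ where $P$ is the orthogonal projection of $\mathcal M$ onto $\mathbb C\Omega_1$. **Conditional freeness.** A family of unital subalgebras $\mathcal A(u)$ of a unital complex algebra is conditionally free with respect to a pair $(\varphi,\psi)$ of linear functionals if $\varphi(a_1\cdots a_m)=0$ whenever $m\ge 1$, $a_i\in\mathcal A(u_i)$ for all $i$, $u_i\ne u_{i+1}$ for $1\le i<m$, $\psi(a_i)=0$ for $1\le i\le m-1$ and $\varphi(a_m)=0$. A family of random matrices is asymptotically conditionally free with respect to $(\tau_1(n),\tau_2(n))$ if its joint moment functionals on $\mathbb C\langle X_u:u\in\mathcal U\rangle$ under $\tau_1(n)$ and $\tau_2(n)$ converge pointwise to linear functionals $\varphi$ and $\psi$, respectively, and the unital subalgebras generated by the single variables $X_u$ are conditionally free with respect to $(\varphi,\psi)$. **Theorem.** 1. The family $\{M(u,n)\}$ is asymptotically conditionally free with respect to the pair of partial traces $(\tau_1(n),\tau_2(n))$. 2. For $q\in\{1,2\}$, $m\ge 0$ and $u_1,\dots,u_m\in\mathcal U$, $$\lim_{n\to\infty}\tau_q(n)\big(M(u_1,n)\cdots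 M(u_m,n)\big)=\Psi_q\big(y(u_1)\cdots y(u_m)\big).$$ 3. The unital $*$-algebras $\mathcal A(u)$ generated by $\wp_1(u),\wp_2(u)$, $u\in\mathcal U$, are conditionally free with respect to $(\Psi_1,\Psi_2)$. -/

import Mathlib

open MeasureTheory ProbabilityTheory Filter Topology

namespace FreeMeixner

/-! ### Conditional freeness -/

/-- A family of unital subalgebras `𝒜 u` of a unital complex algebra is conditionally free with
respect to the pair of functionals `(φ, ψ)`: one has `φ (a₁ a₂ ⋯ aₘ) = 0` whenever `aᵢ ∈ 𝒜 (uᵢ)`,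
consecutive indices `uᵢ, uᵢ₊₁` differ, `a₁, …, aₘ₋₁` lie in the kernel of `ψ`, and the last
factor `aₘ` lies in the kernel of `φ`. (Here `m = k + 1 ≥ 1`.) -/
def CondFree {U A : Type*} [Ring A] [Algebra ℂ A] (φ ψ : A →ₗ[ℂ] ℂ) (𝒜 : U → Subalgebra ℂ A) :
    Prop :=
  ∀ (k : ℕ) (u : Fin (k + 1) → U) (a : Fin (k + 1) → A),
    (∀ i, a i ∈ 𝒜 (u i)) →
    (∀ i : Fin k, u i.castSucc ≠ u i.succ) →
    (∀ i : Fin k, ψ (a i.castSucc) = 0) →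
    φ (a (Fin.last k)) = 0 →
    φ (List.ofFn a).prod = 0

/-- Asymptotic conditional freeness, for two sequences of joint moment functionals `φ n`, `ψ n` on
the noncommutative polynomials `ℂ⟨X_u : u ∈ U⟩`: both sequences converge pointwise, and the
unital subalgebras generated by the single variables `X_u` are conditionally free with respect to
the pair of limit functionals. -/
def AsympCondFree {U : Type*} (φ ψ : ℕ → FreeAlgebra ℂ U → ℂ) : Prop :=
  ∃ φ' ψ' : FreeAlgebra ℂ U →ₗ[ℂ] ℂ,
    (∀ p, Tendsto (fun n => φ n p) atTop (𝓝 (φ' p))) ∧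
    (∀ p, Tendsto (fun n => ψ n p) atTop (𝓝 (ψ' p))) ∧
    CondFree φ' ψ' (fun u => Algebra.adjoin ℂ {FreeAlgebra.ι ℂ u})

/-! ### The random matrices

The values `0, 1 : Fin 2` stand for the block labels `1, 2`. A partition `[n] = N₁ ∪ N₂` into two
disjoint sets is given by the map `blk n : Fin n → Fin 2` which sends an index to the label of the
set containing it. -/

/-- The diagonal projection `I_p(n)` onto the span of the basis vectors indexed by `N_p`. -/
noncomputable def blockUnit {n : ℕ} (blk : Fin n → Fin 2) (p : Fin 2) : Matrix (Fin n) (Fin n) ℂ :=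
  Matrix.diagonal fun i => if blk i = p then 1 else 0

/-- The normalized partial trace `τ_q(n)` of a random matrix: the expectation of the trace over the
basis vectors indexed by `N_q`, divided by `|N_q|`. -/
noncomputable def partialTrace {Ω : Type*} [MeasurableSpace Ω] (P : Measure Ω) {n : ℕ}
    (blk : Fin n → Fin 2) (q : Fin 2) (A : Ω → Matrix (Fin n) (Fin n) ℂ) : ℂ :=
  (((Finset.univ.filter fun i => blk i = q).card : ℂ))⁻¹ *
    ∑ i ∈ Finset.univ.filter (fun i => blk i = q), ∫ ω, A ω i i ∂P

/-- An ensemble `Y(u,n)` of independent Hermitian complex Gaussian random matrices with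
block-identical variances `v_{p,q}(u) / n`, decomposed into blocks by `blk`, with asymptotic
dimensions `d₁ = 0` and `d₂ = 1`. -/
structure IsGaussianBlockEnsemble {Ω U : Type*} [MeasurableSpace Ω] (P : Measure Ω)
    (blk : ∀ n : ℕ, Fin n → Fin 2) (V : U → Matrix (Fin 2) (Fin 2) ℝ)
    (Y : U → ∀ n : ℕ, Ω → Matrix (Fin n) (Fin n) ℂ) : Prop where
  /-- The entries are random variables. -/
  measurable : ∀ u n i j, Measurable fun ω => Y u n ω i j
  /-- The matrices are Hermitian. -/
  isHermitian : ∀ u n ω, (Y u n ω).IsHermitian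
  /-- Real and imaginary parts of the entries are (possibly degenerate) real Gaussian variables. -/
  gaussian_re : ∀ u n i j, HasGaussianLaw (fun ω => (Y u n ω i j).re) P
  gaussian_im : ∀ u n i j, HasGaussianLaw (fun ω => (Y u n ω i j).im) P
  /-- They have mean zero. -/
  mean_re : ∀ u n i j, ∫ ω, (Y u n ω i j).re ∂P = 0
  mean_im : ∀ u n i j, ∫ ω, (Y u n ω i j).im ∂P = 0
  /-- `E |Y_{i,j}(u,n)|² = v_{p,q}(u) / n` for `(i, j) ∈ N_p × N_q`. -/
  variance : ∀ u n i j, ∫ ω, ‖Y u n ω i j‖ ^ 2 ∂P = V u (blk n i) (blk n j) / n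
  /-- The variance matrices are symmetric. -/
  symm : ∀ u, (V u).IsSymm
  /-- For each `n`, the real and imaginary parts (selected by the Boolean) of all entries on and
  above the diagonal of all the matrices `Y(u,n)`, `u ∈ U`, are independent. -/
  indep : ∀ n, iIndepFun (fun (k : U × {p : Fin n × Fin n // p.1 ≤ p.2} × Bool) ω =>
    if k.2.2 then (Y k.1 n ω k.2.1.1.1 k.2.1.1.2).re else (Y k.1 n ω k.2.1.1.1 k.2.1.1.2).im) P
  /-- `N₁` is non-empty for large `n`, so that the first partial trace makes sense. -/
  nonempty : ∀ᶠ n in atTop, ∃ i, blk n i = 0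
  /-- The asymptotic dimensions. -/
  dim₁ : Tendsto (fun n => ((Finset.univ.filter fun i => blk n i = 0).card : ℝ) / n) atTop (𝓝 0)
  dim₂ : Tendsto (fun n => ((Finset.univ.filter fun i => blk n i = 1).card : ℝ) / n) atTop (𝓝 1)

/-- The matrices `M(u,n) = Y(u,n) + α₁(u) I₁(n) + α₂(u) I₂(n)`. -/
noncomputable def meixnerMatrix {Ω U : Type*} (blk : ∀ n : ℕ, Fin n → Fin 2)
    (α : U → Fin 2 → ℝ) (Y : U → ∀ n : ℕ, Ω → Matrix (Fin n) (Fin n) ℂ)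
    (u : U) (n : ℕ) (ω : Ω) : Matrix (Fin n) (Fin n) ℂ :=
  Y u n ω + (α u 0 : ℂ) • blockUnit (blk n) 0 + (α u 1 : ℂ) • blockUnit (blk n) 1

/-- The joint moment functional `p ↦ τ_q(n)(p((M(u,n))_u))` on noncommutative polynomials. -/
noncomputable def momentFunctional {Ω U : Type*} [MeasurableSpace Ω] (P : Measure Ω)
    (blk : ∀ n : ℕ, Fin n → Fin 2) (M : U → ∀ n : ℕ, Ω → Matrix (Fin n) (Fin n) ℂ)
    (q : Fin 2) (n : ℕ) (p : FreeAlgebra ℂ U) : ℂ :=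
  partialTrace P (blk n) q fun ω => FreeAlgebra.lift ℂ (fun u => M u n ω) p

/-! ### The multivariate matricially free Fock space of tracial type -/

/-- The canonical orthonormal basis of the Fock space `ℳ = ℳ₁ ⊕ ℳ₂`, where
`ℳ₁ = ℂ Ω₁ ⊕ ⨁_{k ≥ 0} ℋ₂^{⊗k} ⊗ ℋ₁`, `ℳ₂ = ℂ Ω₂ ⊕ ⨁_{k ≥ 1} ℋ₂^{⊗k}` and
`ℋ_j` has the orthonormal basis `(e_j(u))_{u ∈ U}`. -/
inductive FockBasis (U : Type*) where
  /-- The vacuum vectors: `Ω₁` is `vac 0` and `Ω₂` is `vac 1`. -/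
  | vac (q : Fin 2)
  /-- `tail₁ [u₁, …, u_k] u` is `e₂(u₁) ⊗ ⋯ ⊗ e₂(u_k) ⊗ e₁(u)`, a vector of `ℳ₁`. -/
  | tail₁ (w : List U) (u : U)
  /-- `tail₂ u₁ [u₂, …, u_k]` is `e₂(u₁) ⊗ e₂(u₂) ⊗ ⋯ ⊗ e₂(u_k)`, a vector of `ℳ₂`. -/
  | tail₂ (u : U) (w : List U)

/-- The Fock space `ℳ`, realized as the Hilbert space with orthonormal basis `FockBasis U`. -/
noncomputable abbrev Fock (U : Type*) := lp (fun _ : FockBasis U => ℂ) 2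

/-- The basis vector of `ℳ` labelled by `b`. -/
noncomputable def basisVec {U : Type*} (b : FockBasis U) : Fock U :=
  haveI := Classical.decEq (FockBasis U); lp.single 2 b 1

open Classical in
/-- The partial injection of the basis that underlies `℘₁(u)`: `Ω₁ ↦ e₁(u)`. -/
noncomputable def push₁ {U : Type*} (u : U) : FockBasis U ≃. FockBasis U where
  toFun b := match b with
    | .vac q => if q = 0 then some (.tail₁ [] u) else none
    | _ => none
  invFun b := match b with
    | .tail₁ [] v => if v = u then some (.vac 0) else none
    | _ => none
  inv a b := by
    rcases a with q | ⟨w, v⟩ | ⟨v, w⟩ <;> rcases b with q' | ⟨_ | ⟨x, w'⟩, v'⟩ | ⟨v', w'⟩ <;>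
      (simp; try grind)

open Classical in
/-- The partial injection of the basis that underlies `℘₂(u)`: it puts `e₂(u)` in front of every
basis vector except `Ω₁`. -/
noncomputable def push₂ {U : Type*} (u : U) : FockBasis U ≃. FockBasis U where
  toFun b := match b with
    | .vac q => if q = 1 then some (.tail₂ u []) else none
    | .tail₁ w v => some (.tail₁ (u :: w) v)
    | .tail₂ v w => some (.tail₂ u (v :: w))
  invFun b := match b with
    | .vac _ => none
    | .tail₁ [] _ => none
    | .tail₁ (x :: w) v => if x = u then some (.tail₁ w v) else none
    | .tail₂ x [] => if x = u then some (.vac 1) else none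
    | .tail₂ x (v :: w) => if x = u then some (.tail₂ v w) else none
  inv a b := by
    rcases a with q | ⟨w, v⟩ | ⟨v, w⟩ <;>
      rcases b with q' | ⟨_ | ⟨x, w'⟩, v'⟩ | ⟨v', _ | ⟨x, w'⟩⟩ <;>
      simp <;> grind

/-- The coordinates of the image of `x` under the partial isometry attached to `f`: the coordinate at `b` is the coordinate of `x` at the preimage of `b` under `f`,
or zero if there is none. -/
noncomputable def pullCoord {B : Type*} (f : B ≃. B) (x : B → ℂ) (b : B) : ℂ :=
  (f.symm b).elim 0 x

theorem sum_pullCoord_le' {B : Type*} (f : B ≃. B) (x : B → ℂ) (s : Finset B) :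
    ∑ b ∈ s, ‖pullCoord f x b‖ ^ (2 : ENNReal).toReal ≤
      ∑ c ∈ s.filterMap f.symm (fun _ _ _ h h' => f.symm.inj h h'),
        ‖x c‖ ^ (2 : ENNReal).toReal := by
  classical
  induction s using Finset.induction_on with
  | empty => simp
  | insert a s ha ih =>
    rw [Finset.sum_insert ha]
    rcases h : f.symm a with _ | c
    · have h0 : ‖pullCoord f x a‖ ^ (2 : ENNReal).toReal = 0 := by
        simp [pullCoord, h]
      rw [h0, zero_add]
      refine ih.trans (Finset.sum_le_sum_of_subset_of_nonneg ?_ fun _ _ _ => by positivity)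
      intro b hb
      rw [Finset.mem_filterMap] at hb ⊢
      obtain ⟨b', hb', hb''⟩ := hb
      exact ⟨b', Finset.mem_insert_of_mem hb', hb''⟩
    · have h0 : pullCoord f x a = x c := by simp [pullCoord, h]
      have hc : c ∉ s.filterMap f.symm (fun a a' b h h' => f.symm.inj h h') := by
        intro hc
        rw [Finset.mem_filterMap] at hc
        obtain ⟨b', hb', hb''⟩ := hc
        exact ha (f.symm.inj h hb'' ▸ hb')
      rw [h0]
      refine (add_le_add le_rfl ih).trans ?_
      refine (Finset.sum_insert (f := fun c => ‖x c‖ ^ (2 : ENNReal).toReal) hc).symm.le.trans ?_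
      refine Finset.sum_le_sum_of_subset_of_nonneg ?_ fun _ _ _ => by positivity
      intro b hb
      rw [Finset.mem_filterMap]
      rcases Finset.mem_insert.1 hb with rfl | hb
      · exact ⟨a, Finset.mem_insert_self _ _, h⟩
      · obtain ⟨b', hb', hb''⟩ := (Finset.mem_filterMap _).1 hb
        exact ⟨b', Finset.mem_insert_of_mem hb', hb''⟩

theorem sum_pullCoord_le {B : Type*} (f : B ≃. B) (x : lp (fun _ : B => ℂ) 2) (s : Finset B) :
    ∑ b ∈ s, ‖pullCoord f x b‖ ^ (2 : ENNReal).toReal ≤ ‖x‖ ^ (2 : ENNReal).toReal :=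
  (sum_pullCoord_le' f x s).trans (lp.sum_rpow_le_norm_rpow (by simp) x _)

/-- The partial isometry of `ℓ²(B)` attached to a partial injection `f` of `B`: it sends the basis
vector `b` to the basis vector `f b` if this is defined, and to zero otherwise. -/
noncomputable def partialIsometry {B : Type*} (f : B ≃. B) :
    lp (fun _ : B => ℂ) 2 →L[ℂ] lp (fun _ : B => ℂ) 2 :=
  LinearMap.mkContinuous
    { toFun := fun x => ⟨pullCoord f x, memℓp_gen' (sum_pullCoord_le f x)⟩
      map_add' := fun x y => by
        ext b
        change (f.symm b).elim 0 (fun c => x c + y c) = (f.symm b).elim 0 x + (f.symm b).elim 0 y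
        cases f.symm b <;> simp
      map_smul' := fun c x => by
        ext b
        change (f.symm b).elim 0 (fun d => c * x d) = c * (f.symm b).elim 0 x
        cases f.symm b <;> simp }
    1 (fun x => by
      rw [one_mul]
      exact lp.norm_le_of_forall_sum_le (by simp) (norm_nonneg x) (sum_pullCoord_le f x))

theorem partialIsometry_apply {B : Type*} (f : B ≃. B) (x : lp (fun _ : B => ℂ) 2) (b : B) :
    partialIsometry f x b = (f.symm b).elim 0 x := rfl

/-- The creation operator `℘₁(u)`, with parameter `β₁(u)`. -/
noncomputable def creation₁ {U : Type*} (β : U → Fin 2 → ℝ) (u : U) : Fock U →L[ℂ] Fock U :=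
  ((√(β u 0) : ℝ) : ℂ) • partialIsometry (push₁ u)

/-- The creation operator `℘₂(u)`, with parameter `β₂(u)`. -/
noncomputable def creation₂ {U : Type*} (β : U → Fin 2 → ℝ) (u : U) : Fock U →L[ℂ] Fock U :=
  ((√(β u 1) : ℝ) : ℂ) • partialIsometry (push₂ u)

theorem basisVec_apply {U : Type*} [DecidableEq (FockBasis U)] (b c : FockBasis U) :
    basisVec b c = if c = b then 1 else 0 := by
  by_cases h : c = b
  · subst h
    simp [basisVec]
  · simp [basisVec, h]

theorem partialIsometry_basisVec {U : Type*} (f : FockBasis U ≃. FockBasis U) (b : FockBasis U) :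
    partialIsometry f (basisVec b) = (f b).elim 0 basisVec := by
  classical
  ext c
  rw [partialIsometry_apply]
  have hiff : ∀ d, f.symm c = some d ↔ f d = some c := fun d => f.inv d c
  rcases h : f.symm c with _ | d
  · rcases h' : f b with _ | e
    · rfl
    · have : c ≠ e := by
        rintro rfl
        simp [(hiff b).2 h'] at h
      simp [basisVec_apply, this]
  · have hd := (hiff d).1 h
    rcases h' : f b with _ | e
    · have : d ≠ b := by
        rintro rfl
        simp [hd] at h'
      simp [basisVec_apply, this]
    · have : d = b ↔ c = e := by
        constructor
        · rintro rfl
          simpa [hd] using h'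
        · rintro rfl
          exact f.inj hd h'
      simp [basisVec_apply, this]

section Rules

variable {U : Type*} (β : U → Fin 2 → ℝ) (u : U)

theorem creation₁_vac₁ :
    creation₁ β u (basisVec (.vac 0)) = ((√(β u 0) : ℝ) : ℂ) • basisVec (.tail₁ [] u) := by
  rw [creation₁, smul_apply, partialIsometry_basisVec]; rfl

theorem creation₁_vac₂ : creation₁ β u (basisVec (.vac 1)) = 0 := by
  rw [creation₁, smul_apply, partialIsometry_basisVec]; exact smul_zero _

theorem creation₁_tail₁ (w : List U) (v : U) : creation₁ β u (basisVec (.tail₁ w v)) = 0 := by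
  rw [creation₁, smul_apply, partialIsometry_basisVec]; exact smul_zero _

theorem creation₁_tail₂ (w : List U) (v : U) : creation₁ β u (basisVec (.tail₂ v w)) = 0 := by
  rw [creation₁, smul_apply, partialIsometry_basisVec]; exact smul_zero _

theorem creation₂_vac₁ : creation₂ β u (basisVec (.vac 0)) = 0 := by
  rw [creation₂, smul_apply, partialIsometry_basisVec]; exact smul_zero _

theorem creation₂_vac₂ :
    creation₂ β u (basisVec (.vac 1)) = ((√(β u 1) : ℝ) : ℂ) • basisVec (.tail₂ u []) := by
  rw [creation₂, smul_apply, partialIsometry_basisVec]; rfl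

theorem creation₂_tail₁ (w : List U) (v : U) :
    creation₂ β u (basisVec (.tail₁ w v)) =
      ((√(β u 1) : ℝ) : ℂ) • basisVec (.tail₁ (u :: w) v) := by
  rw [creation₂, smul_apply, partialIsometry_basisVec]; rfl

theorem creation₂_tail₂ (w : List U) (v : U) :
    creation₂ β u (basisVec (.tail₂ v w)) =
      ((√(β u 1) : ℝ) : ℂ) • basisVec (.tail₂ u (v :: w)) := by
  rw [creation₂, smul_apply, partialIsometry_basisVec]; rfl

end Rules

/-- The Gaussian operator `ω(u) = ω₁(u) + ω₂(u)`, where `ω_j(u) = ℘_j(u) + ℘_j(u)*`. -/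
noncomputable def gaussianOp {U : Type*} (β : U → Fin 2 → ℝ) (u : U) : Fock U →L[ℂ] Fock U :=
  (creation₁ β u + (creation₁ β u).adjoint) + (creation₂ β u + (creation₂ β u).adjoint)

/-- The orthogonal projection `P` of `ℳ` onto `ℂ Ω₁`. -/
noncomputable def vacProj (U : Type*) : Fock U →L[ℂ] Fock U :=
  (Submodule.span ℂ {(basisVec (.vac 0) : Fock U)}).starProjection

/-- The operator `γ(u)`, diagonal in the canonical basis: it multiplies `Ω₁` by `α₁(u)` and all the
other basis vectors by `α₂(u)`. -/
noncomputable def gammaOp {U : Type*} (α : U → Fin 2 → ℝ) (u : U) : Fock U →L[ℂ] Fock U :=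
  (α u 0 : ℂ) • vacProj U + (α u 1 : ℂ) • (1 - vacProj U)

/-- The limit operator `y(u) = ω(u) + γ(u)`. -/
noncomputable def limitOp {U : Type*} (α β : U → Fin 2 → ℝ) (u : U) : Fock U →L[ℂ] Fock U :=
  gaussianOp β u + gammaOp α u

/-- The vacuum states: `Ψ₁` is `vacState U 0` and `Ψ₂` is `vacState U 1`, that is,
`Ψ_q(T) = ⟨Ω_q, T Ω_q⟩`. -/
noncomputable def vacState (U : Type*) (q : Fin 2) : (Fock U →L[ℂ] Fock U) →ₗ[ℂ] ℂ where
  toFun T := inner ℂ (basisVec (.vac q)) (T (basisVec (.vac q)))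
  map_add' S T := by simp
  map_smul' c T := by simp

/-- The unital *-algebra `𝒜(u)` generated by `℘₁(u)` and `℘₂(u)`. -/
noncomputable def fockAlgebra {U : Type*} (β : U → Fin 2 → ℝ) (u : U) :
    Subalgebra ℂ (Fock U →L[ℂ] Fock U) :=
  (StarAlgebra.adjoin ℂ {creation₁ β u, creation₂ β u}).toSubalgebra

end FreeMeixner

/-! Write m_1, m_2 for the mixed moments of the y(u) under Ψ_1, Ψ_2 (labels 0 and 1 of `Fin 2`).
They satisfy m_q(uw) = α_q(u) m_q(w) + β_q(u) Σ m_2(a) m_q(b), the sum running over all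
factorizations w = a u b. With m_q = 1 on the empty word this determines them, and the matrix
moments satisfy it asymptotically.

On the Fock space (`vacMoment_cons`) the recursion is a first-return decomposition: a vector of
colour u is created, the marked letter u removes it, and the letters of a in between act above a
vector other than Ω_1, exactly as they would above Ω_2. This is why m_2(a) appears.

For the matrices, Gaussian integration by parts (`entryExp_X_mul`) yields a Schwinger–Dyson equation
(`segExp_cons_cons`): removing a first letter Y_{i,l}(u) differentiates what remains, and
differentiation cuts words at their letters u. The induction runs over expectations of arbitrary
products of entries of words, so no separate concentration estimate is needed: for fixed words these
are close to products of Kronecker deltas and moments, uniformly in the positions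
(`eventually_norm_segExp_sub_segLim_le`). Summing over l averages the first piece over both blocks.
Since |N_1|/n → 0 and |N_2|/n → 1, only the second block survives and gives m_2(a); every other term
forces l to equal a fixed index and costs O(1/n). Uniformity lets the estimate pass to both partial
traces, even over a tiny N_1.

For conditional freeness, an element of 𝒜(u) acts by one and the same matrix along every chain b,
e_2(u) ⊗ b, e_2(u) ⊗ e_2(u) ⊗ b, … whose start b is neither Ω_1 nor of leading colour u
(`actsAlong_chain`). Comparison with b = Ω_2 shows that Ψ_2(a) = 0 makes a send such b to vectors of
leading colour u; Ψ_1(a) = 0 does the same for Ω_1. An alternating product therefore sends Ω_1 into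
the orthogonal complement of Ω_1 (`condFree_fockAlgebra`). The limit moments inherit this since P =
β_1(u)⁻¹ ℘_1(u)*℘_1(u) puts y(u) into 𝒜(u). -/

namespace FreeMeixner

/-! ### Action of the Fock space operators on the canonical basis. -/

section Fock

variable {U : Type*}

theorem inner_basisVec (b : FockBasis U) (x : Fock U) : inner ℂ (basisVec b) x = x b := by
  classical
  unfold basisVec
  rw [lp.inner_single_left]
  simp

theorem adjoint_partialIsometry (f : FockBasis U ≃. FockBasis U) :
    (partialIsometry f).adjoint = partialIsometry f.symm := by
  ext x b
  rw [← inner_basisVec, ContinuousLinearMap.adjoint_inner_right, partialIsometry_basisVec,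
    partialIsometry_apply]
  rcases h : f b with _ | c <;> simp [h, inner_basisVec]

theorem adjoint_creation₁ (β : U → Fin 2 → ℝ) (u : U) :
    (creation₁ β u).adjoint = ((√(β u 0) : ℝ) : ℂ) • partialIsometry (push₁ u).symm := by
  rw [creation₁, LinearIsometryEquiv.map_smulₛₗ, adjoint_partialIsometry, Complex.conj_ofReal]

theorem adjoint_creation₂ (β : U → Fin 2 → ℝ) (u : U) :
    (creation₂ β u).adjoint = ((√(β u 1) : ℝ) : ℂ) • partialIsometry (push₂ u).symm := by
  rw [creation₂, LinearIsometryEquiv.map_smulₛₗ, adjoint_partialIsometry, Complex.conj_ofReal]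

/-- The label of the block in which a basis vector lives: `0` for `Ω₁` and `1` otherwise. -/
def FockBasis.kind : FockBasis U → Fin 2
  | .vac q => q
  | _ => 1

/-- The basis vector obtained by creating a vector of colour `u` in front of the given one. -/
def FockBasis.cons (u : U) : FockBasis U → FockBasis U
  | .vac q => if q = 0 then .tail₁ [] u else .tail₂ u []
  | .tail₁ w v => .tail₁ (u :: w) v
  | .tail₂ v w => .tail₂ u (v :: w)

@[simp] theorem FockBasis.kind_cons (u : U) (b : FockBasis U) : (b.cons u).kind = 1 := by
  rcases b with q | _ | _
  · fin_cases q <;> rfl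
  · rfl
  · rfl

@[simp] theorem FockBasis.kind_vac (q : Fin 2) : (vac q : FockBasis U).kind = q := rfl

theorem FockBasis.cons_ne_vac (u : U) (b : FockBasis U) (q : Fin 2) : b.cons u ≠ vac q := by
  rcases b with r | _ | _
  · fin_cases r <;> simp [cons]
  · simp [cons]
  · simp [cons]

/-- Exactly one of the two creation operators has the given basis vector in its domain, so their sum
is a single creation operator whose weight depends only on whether the vector is Ω_1. -/
theorem creation_basisVec (β : U → Fin 2 → ℝ) (u : U) (b : FockBasis U) :
    creation₁ β u (basisVec b) + creation₂ β u (basisVec b) =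
      ((√(β u b.kind) : ℝ) : ℂ) • basisVec (b.cons u) := by
  rcases b with q | ⟨w, v⟩ | ⟨v, w⟩
  · fin_cases q
    · exact (congrArg₂ (· + ·) (creation₁_vac₁ β u) (creation₂_vac₁ β u)).trans (add_zero _)
    · exact (congrArg₂ (· + ·) (creation₁_vac₂ β u) (creation₂_vac₂ β u)).trans (zero_add _)
  · rw [creation₁_tail₁, creation₂_tail₁, zero_add]; rfl
  · rw [creation₁_tail₂, creation₂_tail₂, zero_add]; rfl

open Classical in
theorem annihilation_cons (β : U → Fin 2 → ℝ) (u v : U) (b : FockBasis U) :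
    (creation₁ β u).adjoint (basisVec (b.cons v)) + (creation₂ β u).adjoint (basisVec (b.cons v)) =
      if v = u then ((√(β u b.kind) : ℝ) : ℂ) • basisVec b else 0 := by
  rw [adjoint_creation₁, adjoint_creation₂, smul_apply, smul_apply, partialIsometry_basisVec,
    partialIsometry_basisVec]
  rcases b with q | ⟨w, x⟩ | ⟨x, w⟩
  · fin_cases q
    · change _ • ((if v = u then some (FockBasis.vac 0) else none : Option (FockBasis U)).elim
        0 basisVec) + _ • ((none : Option (FockBasis U)).elim 0 basisVec) = _
      split_ifs <;> simp
    · change _ • ((none : Option (FockBasis U)).elim 0 basisVec) +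
        _ • ((if v = u then some (FockBasis.vac 1) else none : Option (FockBasis U)).elim
        0 basisVec) = _
      split_ifs <;> simp
  · change _ • ((none : Option (FockBasis U)).elim 0 basisVec) +
        _ • ((if v = u then some (FockBasis.tail₁ w x) else none : Option (FockBasis U)).elim
        0 basisVec) = _
    split_ifs <;> simp [FockBasis.kind]
  · change _ • ((none : Option (FockBasis U)).elim 0 basisVec) +
        _ • ((if v = u then some (FockBasis.tail₂ x w) else none : Option (FockBasis U)).elim
        0 basisVec) = _
    split_ifs <;> simp [FockBasis.kind]

theorem annihilation_vac (β : U → Fin 2 → ℝ) (u : U) (q : Fin 2) :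
    (creation₁ β u).adjoint (basisVec (.vac q)) + (creation₂ β u).adjoint (basisVec (.vac q)) =
      0 := by
  rw [adjoint_creation₁, adjoint_creation₂, smul_apply, smul_apply, partialIsometry_basisVec,
    partialIsometry_basisVec]
  change _ • ((none : Option (FockBasis U)).elim 0 basisVec) +
    _ • ((none : Option (FockBasis U)).elim 0 basisVec) = _
  simp

theorem inner_basisVec_basisVec [DecidableEq (FockBasis U)] (b c : FockBasis U) :
    inner ℂ (basisVec b) (basisVec c) = if b = c then (1 : ℂ) else 0 := by
  rw [inner_basisVec, basisVec_apply]

theorem norm_basisVec (b : FockBasis U) : ‖basisVec b‖ = 1 := by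
  classical
  have h := inner_self_eq_norm_sq_to_K (𝕜 := ℂ) (basisVec b)
  rw [inner_basisVec_basisVec, if_pos rfl] at h
  have h' : ‖basisVec b‖ ^ 2 = 1 := Complex.ofReal_injective (by simpa using h.symm)
  nlinarith [norm_nonneg (basisVec b)]

theorem vacProj_apply (x : Fock U) : vacProj U x = x (.vac 0) • basisVec (.vac 0) := by
  rw [vacProj, Submodule.starProjection_unit_singleton ℂ (norm_basisVec _), inner_basisVec]

theorem gammaOp_basisVec (α : U → Fin 2 → ℝ) (u : U) (b : FockBasis U) :
    gammaOp α u (basisVec b) = (α u b.kind : ℂ) • basisVec b := by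
  classical
  simp only [gammaOp, add_apply, smul_apply, sub_apply,
    one_apply_eq_self, vacProj_apply, basisVec_apply]
  rcases b with q | ⟨w, x⟩ | ⟨x, w⟩
  · fin_cases q <;> simp
  · simp [FockBasis.kind]
  · simp [FockBasis.kind]

open Classical in
-- The three-term relation: diagonal part, creation, and annihilation, the last only when the
-- leading colour agrees. It drives the moment recursion.
theorem limitOp_cons (α β : U → Fin 2 → ℝ) (u v : U) (b : FockBasis U) :
    limitOp α β u (basisVec (b.cons v)) =
      (α u 1 : ℂ) • basisVec (b.cons v) + ((√(β u 1) : ℝ) : ℂ) • basisVec ((b.cons v).cons u) +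
      if v = u then ((√(β u b.kind) : ℝ) : ℂ) • basisVec b else 0 := by
  rw [← annihilation_cons]
  have h := creation_basisVec β u (b.cons v)
  rw [FockBasis.kind_cons] at h
  rw [← h, limitOp, gaussianOp]
  simp only [add_apply, gammaOp_basisVec, FockBasis.kind_cons]
  abel

theorem limitOp_vac (α β : U → Fin 2 → ℝ) (u : U) (q : Fin 2) :
    limitOp α β u (basisVec (.vac q)) =
      (α u q : ℂ) • basisVec (.vac q) +
        ((√(β u q) : ℝ) : ℂ) • basisVec ((FockBasis.vac q).cons u) := by
  have h := creation_basisVec β u (.vac q)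
  have h' := annihilation_vac β u q
  rw [FockBasis.kind_vac] at h
  rw [← h, limitOp, gaussianOp]
  simp only [add_apply, gammaOp_basisVec, FockBasis.kind_vac]
  rw [← add_zero (_ • _ + _), ← h']
  abel

theorem adjoint_limitOp (α β : U → Fin 2 → ℝ) (u : U) :
    (limitOp α β u).adjoint = limitOp α β u := by
  have hP : (vacProj U).adjoint = vacProj U :=
    ContinuousLinearMap.isSelfAdjoint_iff'.1 (isSelfAdjoint_starProjection _)
  have h1 : (1 : Fock U →L[ℂ] Fock U).adjoint = 1 := ContinuousLinearMap.adjoint_id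
  simp only [limitOp, gaussianOp, gammaOp, map_add, map_sub, LinearIsometryEquiv.map_smulₛₗ,
    ContinuousLinearMap.adjoint_adjoint, Complex.conj_ofReal, hP, h1]
  abel

end Fock

/-! ### Decompositions of words -/

section Splits

variable {U : Type*}

open Classical in
/-- The list of pairs `(a, b)` such that `w = a u b`. -/
noncomputable def splits (u : U) : List U → List (List U × List U)
  | [] => []
  | v :: w => (if v = u then [([], w)] else []) ++
      (splits u w).map fun p => (v :: p.1, p.2)

theorem length_of_mem_splits {u : U} {w : List U} {p : List U × List U} (h : p ∈ splits u w) :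
    p.1.length + p.2.length + 1 = w.length := by
  induction w generalizing p with
  | nil => simp [splits] at h
  | cons v w ih =>
    rw [splits, List.mem_append, List.mem_map] at h
    rcases h with h | ⟨p', h', rfl⟩
    · split_ifs at h with hv
      · simp at h; simp [h]
      · simp at h
    · have := ih h'
      simp only [List.length_cons]
      omega

theorem splits_nil (u : U) : splits u [] = [] := rfl

theorem splits_cons_self (u : U) (w : List U) :
    splits u (u :: w) = ([], w) :: (splits u w).map fun p => (u :: p.1, p.2) := by
  rw [splits, if_pos rfl, List.singleton_append]

theorem splits_cons_of_ne {u v : U} (h : v ≠ u) (w : List U) :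
    splits u (v :: w) = (splits u w).map fun p => (v :: p.1, p.2) := by
  rw [splits, if_neg h, List.nil_append]

/-- Coassociativity of the decomposition of words. -/
theorem sum_splits_comm {R : Type*} [Semiring R] (u v : U) (w : List U)
    (F : List U → List U → List U → R) :
    ((splits v w).map fun p => ((splits u p.2).map fun r => F p.1 r.1 r.2).sum).sum =
      ((splits u w).map fun p => ((splits v p.1).map fun r => F r.1 r.2 p.2).sum).sum := by
  induction w generalizing F with
  | nil => simp [splits]
  | cons x w ih =>
    have ih' := ih fun a b c => F (x :: a) b c
    by_cases h : x = v
    · by_cases h' : x = u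
      · subst h; subst h'
        simp [splits_cons_self, splits_nil, Function.comp_def, ih', List.sum_map_add]
      · subst h
        simp [splits_cons_self, splits_cons_of_ne h', Function.comp_def, ih', List.sum_map_add]
    · by_cases h' : x = u
      · subst h'
        simp [splits_cons_self, splits_cons_of_ne h, Function.comp_def, ih', splits_nil]
      · simp [splits_cons_of_ne h, splits_cons_of_ne h', Function.comp_def, ih']

end Splits

/-! ### The recursion for the vacuum moments -/

section Moments

variable {U : Type*} (α β : U → Fin 2 → ℝ)

/-- The mixed moments of the limit operators in the vacuum states. -/
noncomputable def vacMoment (q : Fin 2) (w : List U) : ℂ :=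
  vacState U q (w.map (limitOp α β)).prod

theorem vacMoment_eq (q : Fin 2) (w : List U) : vacMoment α β q w =
    inner ℂ (basisVec (.vac q)) ((w.map (limitOp α β)).prod (basisVec (.vac q))) := rfl

@[simp] theorem vacMoment_nil (q : Fin 2) : vacMoment α β q ([] : List U) = 1 := by
  classical
  rw [vacMoment_eq]
  simp only [List.map_nil, List.prod_nil, one_apply_eq_self]
  rw [inner_basisVec_basisVec, if_pos rfl]

theorem inner_limitOp_cons (u : U) (x y : Fock U) (w : List U) :
    inner ℂ x (((u :: w).map (limitOp α β)).prod y) =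
      inner ℂ (limitOp α β u x) ((w.map (limitOp α β)).prod y) := by
  rw [List.map_cons, List.prod_cons, mul_apply_eq_comp,
    ← ContinuousLinearMap.adjoint_inner_left, adjoint_limitOp]

/-- The one-step recursion is stated conditionally on the inner product formula for the same word,
so that it can be used for shorter words inside the induction that proves this formula. -/
theorem vacMoment_cons_of_inner (hβ : ∀ u q, 0 ≤ β u q) (q : Fin 2) (u : U) (w : List U)
    (h : inner ℂ (basisVec ((FockBasis.vac q).cons u))
        ((w.map (limitOp α β)).prod (basisVec (.vac q))) =
      (√(β u q) : ℝ) *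
        ((splits u w).map fun p => vacMoment α β 1 p.1 * vacMoment α β q p.2).sum) :
    vacMoment α β q (u :: w) = α u q * vacMoment α β q w +
      β u q * ((splits u w).map fun p => vacMoment α β 1 p.1 * vacMoment α β q p.2).sum := by
  rw [vacMoment_eq, inner_limitOp_cons, limitOp_vac, inner_add_left, inner_smul_left,
    inner_smul_left, h, Complex.conj_ofReal, Complex.conj_ofReal, ← vacMoment_eq, ← mul_assoc,
    ← Complex.ofReal_mul, Real.mul_self_sqrt (hβ u q)]

/-- First-passage decomposition: to get from `b.cons u` to Ω_q the leading u must be removed by some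
letter u of the word. The letters before it make an excursion above a vector different from Ω_1,
which contributes a moment in the state Ψ_2; the letters after it start from b. -/
theorem inner_cons_limitOp (hβ : ∀ u q, 0 ≤ β u q) (q : Fin 2) (w : List U) (u : U)
    (b : FockBasis U) :
    inner ℂ (basisVec (b.cons u)) ((w.map (limitOp α β)).prod (basisVec (.vac q))) =
      (√(β u b.kind) : ℝ) * ((splits u w).map fun p => vacMoment α β 1 p.1 *
        inner ℂ (basisVec b) ((p.2.map (limitOp α β)).prod (basisVec (.vac q)))).sum := by
  classical
  induction hm : w.length using Nat.strong_induction_on generalizing w u b q with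
  | _ m ih =>
  subst hm
  rcases w with _ | ⟨v, w⟩
  · simp only [List.map_nil, List.prod_nil, one_apply_eq_self, splits, List.sum_nil,
      mul_zero]
    rw [inner_basisVec_basisVec, if_neg (FockBasis.cons_ne_vac _ _ _)]
  · have ih' : ∀ (w' : List U), w'.length ≤ w.length → ∀ (q : Fin 2) (u : U) (b : FockBasis U),
        inner ℂ (basisVec (b.cons u)) ((w'.map (limitOp α β)).prod (basisVec (.vac q))) =
        (√(β u b.kind) : ℝ) * ((splits u w').map fun p => vacMoment α β 1 p.1 *
          inner ℂ (basisVec b) ((p.2.map (limitOp α β)).prod (basisVec (.vac q)))).sum :=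
      fun w' hw' q u b => ih w'.length (by simp; omega) q w' u b rfl
    set z : List U → ℂ := fun w' =>
      inner ℂ (basisVec b) ((w'.map (limitOp α β)).prod (basisVec (.vac q))) with hz
    -- The term in which v is created on top of u: the v is removed first, then the u.
    -- Coassociativity lets the cut at u be chosen first instead.
    have key : ((splits v w).map fun p => vacMoment α β 1 p.1 * inner ℂ (basisVec (b.cons u))
          ((p.2.map (limitOp α β)).prod (basisVec (.vac q)))).sum =
        (√(β u b.kind) : ℝ) * ((splits u w).map fun p => ((splits v p.1).map fun r =>
          vacMoment α β 1 r.1 * vacMoment α β 1 r.2).sum * z p.2).sum := by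
      have h1 := sum_splits_comm u v w fun x y t => vacMoment α β 1 x * vacMoment α β 1 y * z t
      simp only [List.sum_map_mul_right] at h1
      rw [← h1, ← List.sum_map_mul_left]
      refine congrArg List.sum (List.map_congr_left fun p hp => ?_)
      have := length_of_mem_splits hp
      rw [ih' p.2 (by omega)]
      rw [← mul_assoc, mul_comm (vacMoment α β 1 p.1), mul_assoc, ← List.sum_map_mul_left]
      simp only [hz, mul_assoc]
    -- The target sum involves prefixes starting with v; these are expanded by the recursion for
    -- m_2, available because the prefixes are shorter.
    have key2 : ((splits u w).map fun p => vacMoment α β 1 (v :: p.1) * z p.2).sum =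
        α v 1 * ((splits u w).map fun p => vacMoment α β 1 p.1 * z p.2).sum +
        β v 1 * ((splits u w).map fun p => ((splits v p.1).map fun r =>
          vacMoment α β 1 r.1 * vacMoment α β 1 r.2).sum * z p.2).sum := by
      rw [← List.sum_map_mul_left, ← List.sum_map_mul_left, ← List.sum_map_add]
      refine congrArg List.sum (List.map_congr_left fun p hp => ?_)
      have := length_of_mem_splits hp
      rw [vacMoment_cons_of_inner α β hβ 1 v p.1 (ih' p.1 (by omega) 1 v (.vac 1))]
      ring
    rw [inner_limitOp_cons, limitOp_cons, inner_add_left, inner_add_left, inner_smul_left,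
      inner_smul_left, ih' w le_rfl q v (b.cons u), ih' w le_rfl q u b, FockBasis.kind_cons, key,
      Complex.conj_ofReal, Complex.conj_ofReal]
    simp only [splits, List.map_append, List.sum_append, List.map_map, Function.comp_def]
    rw [key2]
    have hs : ((√(β v 1) : ℝ) : ℂ) * ((√(β v 1) : ℝ) : ℂ) = β v 1 := by
      rw [← Complex.ofReal_mul, Real.mul_self_sqrt (hβ v 1)]
    rw [← hs]
    -- If u = v, the cut at the first letter has an empty prefix and accounts for the immediate
    -- annihilation of u.
    by_cases h : u = v
    · subst h
      simp only [if_true, inner_smul_left, Complex.conj_ofReal, List.map_cons, List.map_nil,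
        List.sum_cons, List.sum_nil, vacMoment_nil]
      simp only [hz]
      ring
    · rw [if_neg h, if_neg (Ne.symm h)]
      simp only [inner_zero_left, List.map_nil, List.sum_nil]
      ring

theorem vacMoment_cons (hβ : ∀ u q, 0 ≤ β u q) (q : Fin 2) (u : U) (w : List U) :
    vacMoment α β q (u :: w) = α u q * vacMoment α β q w +
      β u q * ((splits u w).map fun p => vacMoment α β 1 p.1 * vacMoment α β q p.2).sum :=
  vacMoment_cons_of_inner α β hβ q u w (inner_cons_limitOp α β hβ q w u (.vac q))

end Moments

/-! ### Conditional freeness on the Fock space. -/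

section CondFree

variable {U : Type*}

/-- The linear map from finitely supported sequences to the Fock space given by a sequence of
basis vectors. -/
noncomputable def chainMap (F : ℕ → FockBasis U) : (ℕ →₀ ℂ) →ₗ[ℂ] Fock U :=
  Finsupp.linearCombination ℂ fun k => basisVec (F k)

theorem chainMap_single (F : ℕ → FockBasis U) (k : ℕ) :
    chainMap F (Finsupp.single k 1) = basisVec (F k) := by
  simp [chainMap]

/-- The operator `T` acts along all the sequences in `S` by one and the same matrix. -/
def ActsAlong (S : Set (ℕ → FockBasis U)) (T : Fock U →L[ℂ] Fock U) : Prop :=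
  ∃ c : (ℕ →₀ ℂ) →ₗ[ℂ] (ℕ →₀ ℂ), ∀ F ∈ S, T.toLinearMap ∘ₗ chainMap F = chainMap F ∘ₗ c

theorem actsAlong_of_basis {S : Set (ℕ → FockBasis U)} {T : Fock U →L[ℂ] Fock U}
    (c : ℕ → (ℕ →₀ ℂ)) (h : ∀ F ∈ S, ∀ k, T (basisVec (F k)) = chainMap F (c k)) :
    ActsAlong S T := by
  refine ⟨Finsupp.linearCombination ℂ c, fun F hF => Finsupp.lhom_ext' fun k =>
    LinearMap.ext_ring ?_⟩
  simpa [chainMap] using h F hF k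

theorem ActsAlong.add {S : Set (ℕ → FockBasis U)} {T T' : Fock U →L[ℂ] Fock U}
    (h : ActsAlong S T) (h' : ActsAlong S T') : ActsAlong S (T + T') := by
  obtain ⟨c, hc⟩ := h
  obtain ⟨c', hc'⟩ := h'
  refine ⟨c + c', fun F hF => ?_⟩
  rw [LinearMap.comp_add, ← hc F hF, ← hc' F hF]
  rfl

theorem ActsAlong.mul {S : Set (ℕ → FockBasis U)} {T T' : Fock U →L[ℂ] Fock U}
    (h : ActsAlong S T) (h' : ActsAlong S T') : ActsAlong S (T * T') := by
  obtain ⟨c, hc⟩ := h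
  obtain ⟨c', hc'⟩ := h'
  refine ⟨c ∘ₗ c', fun F hF => ?_⟩
  rw [← LinearMap.comp_assoc, ← hc F hF, LinearMap.comp_assoc, ← hc' F hF]
  rfl

theorem ActsAlong.smul {S : Set (ℕ → FockBasis U)} {T : Fock U →L[ℂ] Fock U}
    (z : ℂ) (h : ActsAlong S T) : ActsAlong S (z • T) := by
  obtain ⟨c, hc⟩ := h
  refine ⟨z • c, fun F hF => ?_⟩
  rw [LinearMap.comp_smul, ← hc F hF]
  rfl

theorem ActsAlong.one (S : Set (ℕ → FockBasis U)) : ActsAlong S 1 :=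
  ⟨LinearMap.id, fun _ _ => rfl⟩

/-- A partial injection that acts along the sequences in `S` by a partial map of the indices. -/
theorem actsAlong_partialIsometry {S : Set (ℕ → FockBasis U)} (f : FockBasis U ≃. FockBasis U)
    (g : ℕ → Option ℕ) (h : ∀ F ∈ S, ∀ k, f (F k) = (g k).map F) :
    ActsAlong S (partialIsometry f) := by
  refine actsAlong_of_basis (fun k => (g k).elim 0 fun j => Finsupp.single j 1) fun F hF k => ?_
  rw [partialIsometry_basisVec, h F hF k]
  rcases g k with _ | j
  · simp
  · simp [chainMap_single]

/-- Acting along a family of sequences is preserved by sums, products and scalars, so it only has to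
be checked on the creation operators and their adjoints. -/
theorem actsAlong_fockAlgebra {S : Set (ℕ → FockBasis U)} (β : U → Fin 2 → ℝ) (u : U)
    (h₁ : ActsAlong S (partialIsometry (push₁ u)))
    (h₁' : ActsAlong S (partialIsometry (push₁ u).symm))
    (h₂ : ActsAlong S (partialIsometry (push₂ u)))
    (h₂' : ActsAlong S (partialIsometry (push₂ u).symm))
    {a : Fock U →L[ℂ] Fock U} (ha : a ∈ fockAlgebra β u) : ActsAlong S a := by
  rw [fockAlgebra, StarAlgebra.adjoin_toSubalgebra] at ha
  induction ha using Algebra.adjoin_induction with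
  | mem x hx =>
    rcases hx with (rfl | rfl) | hx
    · exact h₁.smul _
    · exact h₂.smul _
    · rw [Set.mem_star, ContinuousLinearMap.star_eq_adjoint] at hx
      rcases hx with hx | hx
      · have : x = (creation₁ β u).adjoint := by rw [← hx, ContinuousLinearMap.adjoint_adjoint]
        rw [this, adjoint_creation₁]
        exact h₁'.smul _
      · have : x = (creation₂ β u).adjoint := by rw [← hx, ContinuousLinearMap.adjoint_adjoint]
        rw [this, adjoint_creation₂]
        exact h₂'.smul _
  | algebraMap r =>
    rw [Algebra.algebraMap_eq_smul_one]
    exact (ActsAlong.one S).smul r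
  | add x y _ _ hx hy => exact hx.add hy
  | mul x y _ _ hx hy => exact hx.mul hy

/-- The colour of the leading factor of a basis vector. -/
def FockBasis.lead : FockBasis U → Option U
  | .vac _ => none
  | .tail₁ [] u => some u
  | .tail₁ (u :: _) _ => some u
  | .tail₂ u _ => some u

@[simp] theorem FockBasis.lead_cons (u : U) (b : FockBasis U) : (b.cons u).lead = some u := by
  rcases b with q | _ | _
  · fin_cases q <;> rfl
  · rfl
  · rfl

/-- The sequence of basis vectors obtained from `b` by repeatedly creating the colour `u`. -/
def chain (u : U) (b : FockBasis U) (k : ℕ) : FockBasis U := (FockBasis.cons u)^[k] b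

theorem chain_succ (u : U) (b : FockBasis U) (k : ℕ) :
    chain u b (k + 1) = (chain u b k).cons u := Function.iterate_succ_apply' _ _ _

theorem lead_chain_succ (u : U) (b : FockBasis U) (k : ℕ) :
    (chain u b (k + 1)).lead = some u := by
  rw [chain_succ, FockBasis.lead_cons]

theorem push₂_of_ne {u : U} {b : FockBasis U} (hb : b ≠ .vac 0) : push₂ u b = some (b.cons u) := by
  rcases b with q | _ | _
  · fin_cases q
    · exact absurd rfl hb
    · rfl
  · rfl
  · rfl

theorem push₁_of_ne {u : U} {b : FockBasis U} (hb : b ≠ .vac 0) : push₁ u b = none := by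
  rcases b with q | _ | _
  · fin_cases q
    · exact absurd rfl hb
    · rfl
  · rfl
  · rfl

theorem push₂_symm_of_lead_ne {u : U} {b : FockBasis U} (hb : b.lead ≠ some u) :
    (push₂ u).symm b = none := by
  rcases b with q | ⟨_ | ⟨x, w⟩, v⟩ | ⟨v, _ | ⟨x, w⟩⟩
  · rfl
  · rfl
  all_goals exact if_neg fun h => hb (congrArg some h)

theorem push₁_symm_of_lead_ne {u : U} {b : FockBasis U} (hb : b.lead ≠ some u) :
    (push₁ u).symm b = none := by
  rcases b with q | ⟨_ | ⟨x, w⟩, v⟩ | ⟨v, w⟩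
  · rfl
  · exact if_neg fun h => hb (congrArg some h)
  · rfl
  · rfl

theorem push₂_symm_cons {u : U} {b : FockBasis U} (hb : b ≠ .vac 0) :
    (push₂ u).symm (b.cons u) = some b :=
  ((push₂ u).inv _ _).2 (push₂_of_ne hb)

theorem push₁_symm_cons {u : U} {b : FockBasis U} (hb : b ≠ .vac 0) :
    (push₁ u).symm (b.cons u) = none := by
  rcases h : (push₁ u).symm (b.cons u) with _ | c
  · rfl
  · have hc : push₁ u c = some (b.cons u) := ((push₁ u).inv _ _).1 h
    by_cases h0 : c = .vac 0
    · subst h0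
      have hc' : push₁ u (.vac 0) = some (.tail₁ [] u) := rfl
      rw [hc', Option.some_inj] at hc
      rcases b with q | _ | _
      · fin_cases q
        · exact absurd rfl hb
        · simp [FockBasis.cons] at hc
      · simp [FockBasis.cons] at hc
      · simp [FockBasis.cons] at hc
    · rw [push₁_of_ne h0] at hc
      simp at hc

theorem chain_ne_vac {u : U} {b : FockBasis U} (hb : b ≠ .vac 0) (k : ℕ) :
    chain u b k ≠ .vac 0 := by
  rcases k with _ | k
  · exact hb
  · rw [chain_succ]
    exact FockBasis.cons_ne_vac _ _ _

/-- Along such a chain ℘_1(u) and its adjoint vanish, while ℘_2(u) is the unilateral shift up to a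
scalar. The condition on the leading colour makes the adjoint shift kill the start of the chain,
whatever the start is. -/
theorem actsAlong_chain (β : U → Fin 2 → ℝ) (u : U) {a : Fock U →L[ℂ] Fock U}
    (ha : a ∈ fockAlgebra β u) :
    ActsAlong {F | ∃ b : FockBasis U, b ≠ .vac 0 ∧ b.lead ≠ some u ∧ F = chain u b} a := by
  refine actsAlong_fockAlgebra β u ?_ ?_ ?_ ?_ ha
  · refine actsAlong_partialIsometry _ (fun _ => none) ?_
    rintro _ ⟨b, hb, hu, rfl⟩ k
    exact push₁_of_ne (chain_ne_vac hb k)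
  · refine actsAlong_partialIsometry _ (fun _ => none) ?_
    rintro _ ⟨b, hb, hu, rfl⟩ (_ | k)
    · exact push₁_symm_of_lead_ne hu
    · rw [chain_succ]
      exact push₁_symm_cons (chain_ne_vac hb k)
  · refine actsAlong_partialIsometry _ (fun k => some (k + 1)) ?_
    rintro _ ⟨b, hb, hu, rfl⟩ k
    rw [push₂_of_ne (chain_ne_vac hb k), Option.map_some, chain_succ]
  · refine actsAlong_partialIsometry _ (fun k => k.rec none fun j _ => some j) ?_
    rintro _ ⟨b, hb, hu, rfl⟩ (_ | k)
    · exact push₂_symm_of_lead_ne hu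
    · rw [chain_succ]
      exact push₂_symm_cons (chain_ne_vac hb k)

/-- The chain of Ω_1 is exceptional: its first step is made by ℘_1(u) and all later ones by ℘_2(u),
so the index maps for ℘_2(u) and its adjoint start at 1 instead of 0. -/
theorem actsAlong_vac (β : U → Fin 2 → ℝ) (u : U) {a : Fock U →L[ℂ] Fock U}
    (ha : a ∈ fockAlgebra β u) : ActsAlong {chain u (.vac 0)} a := by
  have hne : ∀ k, chain u (.vac 0) (k + 1) ≠ .vac 0 := fun k => by
    rw [chain_succ]
    exact FockBasis.cons_ne_vac _ _ _
  refine actsAlong_fockAlgebra β u ?_ ?_ ?_ ?_ ha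
  · refine actsAlong_partialIsometry _ (fun k => k.rec (some 1) fun _ _ => none) ?_
    rintro _ rfl (_ | k)
    · rfl
    · exact push₁_of_ne (hne k)
  · refine actsAlong_partialIsometry _
      (fun k => k.rec none fun j _ => j.rec (some 0) fun _ _ => none) ?_
    rintro _ rfl (_ | _ | k)
    · rfl
    · exact if_pos rfl
    · rw [chain_succ]
      exact push₁_symm_cons (hne k)
  · refine actsAlong_partialIsometry _ (fun k => k.rec none fun j _ => some (j + 2)) ?_
    rintro _ rfl (_ | k)
    · rfl
    · rw [push₂_of_ne (hne k), Option.map_some, chain_succ _ _ (k + 1)]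
  · refine actsAlong_partialIsometry _
      (fun k => k.rec none fun j _ => j.rec none fun i _ => some (i + 1)) ?_
    rintro _ rfl (_ | _ | k)
    · rfl
    · rfl
    · rw [chain_succ]
      exact push₂_symm_cons (hne k)

/-- The span of the basis vectors with leading colour `u`. -/
noncomputable def leadSpan (u : U) : Submodule ℂ (Fock U) :=
  Submodule.span ℂ (basisVec '' {b | b.lead = some u})

theorem basisVec_mem_leadSpan {u : U} {b : FockBasis U} (h : b.lead = some u) :
    basisVec b ∈ leadSpan u :=
  Submodule.subset_span ⟨b, h, rfl⟩

theorem chainMap_mem_leadSpan (u : U) (b : FockBasis U) (c : ℕ →₀ ℂ) (h : c 0 = 0) :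
    chainMap (chain u b) c ∈ leadSpan u := by
  rw [chainMap, Finsupp.linearCombination_apply]
  refine Submodule.sum_mem _ fun k hk => Submodule.smul_mem _ _ ?_
  rcases k with _ | k
  · exact absurd h (Finsupp.mem_support_iff.1 hk)
  · exact basisVec_mem_leadSpan (lead_chain_succ u b k)

theorem apply_vac_of_mem_leadSpan {u : U} {x : Fock U} (hx : x ∈ leadSpan u) (q : Fin 2) :
    x (.vac q) = 0 := by
  classical
  induction hx using Submodule.span_induction with
  | mem x hx =>
    obtain ⟨b, hb, rfl⟩ := hx
    rw [basisVec_apply, if_neg]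
    rintro rfl
    simp [FockBasis.lead] at hb
  | zero => rfl
  | add x y _ _ hx hy => exact (congrArg₂ (· + ·) hx hy).trans (add_zero 0)
  | smul z x _ hx => exact (congrArg (z * ·) hx).trans (mul_zero z)

theorem vacState_apply (q : Fin 2) (a : Fock U →L[ℂ] Fock U) :
    vacState U q a = a (basisVec (.vac q)) (.vac q) :=
  inner_basisVec _ _

/-- All terms of the chain after the first have leading colour u and hence no vacuum component, so
the vacuum expectation reads off the coefficient at index 0. -/
theorem chainMap_chain_vac_apply (u : U) (q : Fin 2) (c : ℕ →₀ ℂ) :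
    chainMap (chain u (.vac q)) c (.vac q) = c 0 := by
  classical
  have h : c = Finsupp.single 0 (c 0) + (c - Finsupp.single 0 (c 0)) := by abel
  have h' := apply_vac_of_mem_leadSpan
    (chainMap_mem_leadSpan u (.vac q) (c - Finsupp.single 0 (c 0)) (by simp)) q
  have h0 : chainMap (chain u (.vac q)) (Finsupp.single 0 (c 0)) = c 0 • basisVec (.vac q) := by
    simp [chainMap, chain]
  rw [h, map_add, h0]
  refine (congrArg₂ (· + ·) rfl h').trans ?_
  rw [add_zero]
  refine (congrArg (c 0 * ·) ((basisVec_apply _ _).trans (if_pos rfl))).trans ?_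
  simp

/-- An element of the algebra of colour `u` in the kernel of `Ψ₂` maps vectors with another leading
colour to vectors with leading colour `u`. -/
theorem map_leadSpan (β : U → Fin 2 → ℝ) {u v : U} (huv : u ≠ v) {a : Fock U →L[ℂ] Fock U}
    (ha : a ∈ fockAlgebra β u) (h0 : vacState U 1 a = 0) {x : Fock U} (hx : x ∈ leadSpan v) :
    a x ∈ leadSpan u := by
  obtain ⟨c, hc⟩ := actsAlong_chain β u ha
  have key : ∀ b : FockBasis U, b ≠ .vac 0 → b.lead ≠ some u →
      a (basisVec b) = chainMap (chain u b) (c (Finsupp.single 0 1)) := fun b hb hb' => by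
    have := LinearMap.congr_fun (hc _ ⟨b, hb, hb', rfl⟩) (Finsupp.single 0 1)
    simpa [chainMap_single, chain] using this
  -- The matrix c is common to all admissible chains, so its corner entry can be computed on the
  -- chain of Ω_2, where it equals Ψ_2(a).
  have hzero : c (Finsupp.single 0 1) 0 = 0 := by
    rw [vacState_apply, key _ (by simp) (by simp [FockBasis.lead]),
      chainMap_chain_vac_apply] at h0
    exact h0
  induction hx using Submodule.span_induction with
  | mem x hx =>
    obtain ⟨b, hb, rfl⟩ := hx
    rw [key b (by rintro rfl; simp [FockBasis.lead] at hb)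
      (by rw [Set.mem_ofPred_eq] at hb; rw [hb]; simpa using huv.symm)]
    exact chainMap_mem_leadSpan _ _ _ hzero
  | zero => rw [map_zero]; exact zero_mem _
  | add x y _ _ hx hy => rw [map_add]; exact add_mem hx hy
  | smul z x _ hx => rw [map_smul]; exact Submodule.smul_mem _ _ hx

theorem map_vac_mem_leadSpan (β : U → Fin 2 → ℝ) {u : U} {a : Fock U →L[ℂ] Fock U}
    (ha : a ∈ fockAlgebra β u) (h0 : vacState U 0 a = 0) :
    a (basisVec (.vac 0)) ∈ leadSpan u := by
  obtain ⟨c, hc⟩ := actsAlong_vac β u ha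
  have key : a (basisVec (.vac 0)) = chainMap (chain u (.vac 0)) (c (Finsupp.single 0 1)) := by
    have := LinearMap.congr_fun (hc _ rfl) (Finsupp.single 0 1)
    simpa [chainMap_single, chain] using this
  rw [vacState_apply, key, chainMap_chain_vac_apply] at h0
  rw [key]
  exact chainMap_mem_leadSpan _ _ _ h0

/-- The rightmost factor moves Ω_1 to vectors of its own colour, and each further factor replaces
the leading colour by its own; the result never has a component along Ω_1. -/
theorem condFree_fockAlgebra (β : U → Fin 2 → ℝ) :
    CondFree (vacState U 0) (vacState U 1) (fockAlgebra β) := by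
  intro k u a ha hu hψ hφ
  have key : (List.ofFn a).prod (basisVec (.vac 0)) ∈ leadSpan (u 0) := by
    induction k with
    | zero =>
      rw [List.ofFn_succ, List.ofFn_zero, List.prod_singleton]
      exact map_vac_mem_leadSpan β (ha 0) hφ
    | succ k ih =>
      rw [List.ofFn_succ, List.prod_cons, mul_apply_eq_comp]
      refine map_leadSpan β (hu 0) (ha 0) (hψ 0) ?_
      exact ih (fun i => u i.succ) (fun i => a i.succ) (fun i => ha _)
        (fun i => hu i.succ) (fun i => hψ i.succ) hφ
  rw [vacState_apply]
  exact apply_vac_of_mem_leadSpan key 0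

/-- The limit operators belong to the algebras generated by the creation operators. -/
theorem limitOp_mem_fockAlgebra (α β : U → Fin 2 → ℝ) (u : U) (hβ : 0 < β u 0) :
    limitOp α β u ∈ fockAlgebra β u := by
  have h₁ : creation₁ β u ∈ StarAlgebra.adjoin ℂ {creation₁ β u, creation₂ β u} :=
    StarAlgebra.subset_adjoin ℂ _ (by simp)
  have h₂ : creation₂ β u ∈ StarAlgebra.adjoin ℂ {creation₁ β u, creation₂ β u} :=
    StarAlgebra.subset_adjoin ℂ _ (by simp)
  -- Strict positivity of β_1(u) enters here: up to the factor β_1(u), the projection onto Ω_1 is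
  -- the initial projection of ℘_1(u).
  have hP : vacProj U = ((β u 0 : ℝ) : ℂ)⁻¹ • (star (creation₁ β u) * creation₁ β u) := by
    classical
    rw [ContinuousLinearMap.star_eq_adjoint, adjoint_creation₁, creation₁, smul_mul_smul_comm,
      ← Complex.ofReal_mul, Real.mul_self_sqrt hβ.le, smul_smul,
      inv_mul_cancel₀ (by exact_mod_cast hβ.ne'), one_smul]
    ext x b
    rw [vacProj_apply, mul_apply_eq_comp, partialIsometry_apply, PEquiv.symm_symm]
    change x (.vac 0) * basisVec (.vac 0) b = _
    rw [basisVec_apply]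
    by_cases hb : b = .vac 0
    · subst hb
      rw [if_pos rfl, mul_one]
      have h : push₁ u (.vac 0) = some (.tail₁ [] u) := rfl
      have h' : (push₁ u).symm (.tail₁ [] u) = some (.vac 0) := if_pos rfl
      rw [h, Option.elim_some, partialIsometry_apply, h', Option.elim_some]
    · rw [if_neg hb, mul_zero, push₁_of_ne hb, Option.elim_none]
  have hP' : vacProj U ∈ StarAlgebra.adjoin ℂ {creation₁ β u, creation₂ β u} := by
    rw [hP]
    exact SMulMemClass.smul_mem _ (mul_mem (star_mem h₁) h₁)
  change limitOp α β u ∈ StarAlgebra.adjoin ℂ {creation₁ β u, creation₂ β u}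
  refine add_mem (add_mem (add_mem h₁ (star_mem h₁)) (add_mem h₂ (star_mem h₂)))
    (add_mem (SMulMemClass.smul_mem _ hP') (SMulMemClass.smul_mem _ (sub_mem (one_mem _) hP')))

end CondFree

/-! ### Gaussian integration by parts for polynomials -/

section GaussianMoments

open scoped NNReal ENNReal

theorem integrable_pow_gaussianReal (v : ℝ≥0) (m : ℕ) :
    Integrable (fun x : ℝ => x ^ m) (gaussianReal 0 v) := by
  have h : MemLp (id : ℝ → ℝ) m (gaussianReal 0 v) := by
    simpa using memLp_id_gaussianReal (μ := 0) (v := v) (m : ℝ≥0)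
  refine (integrable_norm_iff (by fun_prop)).1 ?_
  simpa using h.integrable_norm_pow'

/-- Stein's identity for monomials, by integrating x^(m+1) · (x · density) by parts. -/
theorem integral_pow_gaussianReal (v : ℝ≥0) (m : ℕ) :
    ∫ x, x ^ (m + 2) ∂gaussianReal 0 v = (m + 1) * v * ∫ x, x ^ m ∂gaussianReal 0 v := by
  -- The degenerate law is the Dirac mass at 0, which has no density.
  by_cases hv : v = 0
  · subst hv
    simp [gaussianReal_zero_var]
  have hint : ∀ k : ℕ, Integrable (fun x : ℝ => x ^ k * gaussianPDFReal 0 v x) := fun k => by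
    have h := integrable_pow_gaussianReal v k
    rw [gaussianReal_of_var_ne_zero _ hv, integrable_withDensity_iff (by fun_prop)
      (ae_of_all _ fun _ => gaussianPDF_lt_top)] at h
    simpa using h
  -- The Gaussian density g satisfies (-v g)' = x g.
  have hd : ∀ x : ℝ, HasDerivAt (fun x => -(v * gaussianPDFReal 0 v x))
      (x * gaussianPDFReal 0 v x) x := fun x => by
    have hg : gaussianPDFReal 0 v =
        fun x => (√(2 * Real.pi * v))⁻¹ * Real.exp (-x ^ 2 / (2 * v)) := by
      ext y
      simp [gaussianPDFReal]
    have h1 : HasDerivAt (fun x : ℝ => -x ^ 2 / (2 * v)) (-x / v) x :=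
      ((hasDerivAt_pow 2 x).neg.div_const (2 * (v : ℝ))).congr_deriv (by
        push_cast
        field_simp)
    rw [hg]
    refine ((h1.exp.const_mul ((√(2 * Real.pi * v))⁻¹)).const_mul (v : ℝ)).neg.congr_deriv ?_
    have : (v : ℝ) ≠ 0 := by exact_mod_cast hv
    field_simp
  have hu : ∀ x : ℝ, HasDerivAt (fun x : ℝ => x ^ (m + 1)) ((m + 1) * x ^ m) x := fun x => by
    simpa using hasDerivAt_pow (m + 1) x
  have h := integral_mul_deriv_eq_deriv_mul_of_integrable (u := fun x : ℝ => x ^ (m + 1))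
    (u' := fun x => (m + 1) * x ^ m) (v := fun x => -(v * gaussianPDFReal 0 v x))
    (v' := fun x => x * gaussianPDFReal 0 v x) (fun x _ => hu x) (fun x _ => hd x)
    (by
      refine (hint (m + 2)).congr (ae_of_all _ fun x => ?_)
      simp only [Pi.mul_apply]; ring)
    (by
      refine ((hint m).const_mul (-((m + 1) * v))).congr (ae_of_all _ fun x => ?_)
      simp only [Pi.mul_apply]; ring)
    (by
      refine ((hint (m + 1)).const_mul (-v)).congr (ae_of_all _ fun x => ?_)
      simp only [Pi.mul_apply]; ring)
  rw [integral_gaussianReal_eq_integral_smul hv, integral_gaussianReal_eq_integral_smul hv,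
    ← integral_const_mul]
  calc _ = ∫ x : ℝ, x ^ (m + 1) * (x * gaussianPDFReal 0 v x) := by
        refine integral_congr_ae (ae_of_all _ fun x => ?_)
        simp only [smul_eq_mul]; ring
    _ = _ := by
        rw [h, ← integral_neg]
        refine integral_congr_ae (ae_of_all _ fun x => ?_)
        simp only [smul_eq_mul]; ring

variable {Ω : Type*} [MeasurableSpace Ω] {P : Measure Ω}

theorem integral_pow_of_hasGaussianLaw {X : Ω → ℝ} (hX : HasGaussianLaw X P)
    (h0 : ∫ ω, X ω ∂P = 0) (m : ℕ) :
    ∫ ω, X ω ^ (m + 2) ∂P = (m + 1) * (∫ ω, X ω ^ 2 ∂P) * ∫ ω, X ω ^ m ∂P := by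
  have hmap := hX.map_eq_gaussianReal
  rw [h0] at hmap
  have key : ∀ k : ℕ, ∫ ω, X ω ^ k ∂P = ∫ x, x ^ k ∂gaussianReal 0 (Var[X; P]).toNNReal :=
    fun k => by
      rw [← hmap, integral_map hX.aemeasurable (by fun_prop)]
  rw [key, key, key, integral_pow_gaussianReal]
  have := integral_pow_gaussianReal (Var[X; P]).toNNReal 0
  simp only [zero_add, pow_zero, integral_const, probReal_univ, smul_eq_mul, mul_one,
    Nat.cast_zero, one_mul] at this
  rw [this]

theorem integral_ofReal_pow {X : Ω → ℝ} (k : ℕ) :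
    ∫ ω, (X ω : ℂ) ^ k ∂P = ((∫ ω, X ω ^ k ∂P : ℝ) : ℂ) := by
  rw [← integral_complex_ofReal]
  simp

theorem integral_ofReal_pow_of_hasGaussianLaw {X : Ω → ℝ} (hX : HasGaussianLaw X P)
    (h0 : ∫ ω, X ω ∂P = 0) (m : ℕ) :
    ∫ ω, (X ω : ℂ) ^ (m + 1) ∂P =
      ((∫ ω, X ω ^ 2 ∂P : ℝ) : ℂ) * (m * ∫ ω, (X ω : ℂ) ^ (m - 1) ∂P) := by
  rw [integral_ofReal_pow, integral_ofReal_pow]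
  -- At m = 0 the truncated exponent m - 1 is harmless: its factor m vanishes, and the left side is
  -- the mean.
  rcases m with _ | m
  · simp [h0]
  · rw [integral_pow_of_hasGaussianLaw hX h0]
    push_cast
    ring

/-- If all the `Z k` have finite moments, so do the polynomials in them. -/
theorem memLp_aeval [IsFiniteMeasure P] {K : Type*} {Z : K → Ω → ℂ}
    (hZ : ∀ k (p : ℝ≥0∞), p ≠ ∞ → MemLp (Z k) p P) (f : MvPolynomial K ℂ) (p : ℝ≥0∞)
    (hp : p ≠ ∞) : MemLp (fun ω => MvPolynomial.aeval (fun k => Z k ω) f) p P := by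
  induction f using MvPolynomial.induction_on generalizing p with
  | C a => simpa using memLp_const a
  | add f g hf hg =>
    simp only [map_add]
    exact (hf p hp).add (hg p hp)
  | mul_X f k hf =>
    -- By Hölder each multiplication doubles the exponent, so all finite exponents are carried
    -- through the induction.
    have h2 : 2 * p ≠ ∞ := ENNReal.mul_ne_top (by simp) hp
    have : ENNReal.HolderTriple (2 * p) (2 * p) p := ⟨by
      rw [ENNReal.mul_inv (by simp) (by simp), ← two_mul, ← mul_assoc,
        ENNReal.mul_inv_cancel (by simp) (by simp), one_mul]⟩
    simpa using (hZ k _ h2).mul' (hf _ h2)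

/-- The expectation of polynomials in random variables all of whose mixed moments are finite. -/
noncomputable def polyExp {K : Type*} (P : Measure Ω) (Z : K → Ω → ℂ)
    (h : ∀ f : MvPolynomial K ℂ,
      Integrable (fun ω => MvPolynomial.aeval (fun k => Z k ω) f) P) :
    MvPolynomial K ℂ →ₗ[ℂ] ℂ where
  toFun f := ∫ ω, MvPolynomial.aeval (fun k => Z k ω) f ∂P
  map_add' f g := by
    simp only [map_add]
    exact integral_add (h f) (h g)
  map_smul' c f := by
    simp only [map_smul, RingHom.id_apply]
    exact integral_smul c _

theorem memLp_ofReal_of_hasGaussianLaw {X : Ω → ℝ} (hX : HasGaussianLaw X P) (p : ℝ≥0∞)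
    (hp : p ≠ ∞) : MemLp (fun ω => (X ω : ℂ)) p P :=
  (hX.memLp hp).ofReal

/-- S may be larger than the support, so that monomials with different supports can be factored over
a common index set. -/
theorem integral_monomial_of_iIndepFun {K : Type*} {Z : K → Ω → ℝ} (hind : iIndepFun Z P)
    (hm : ∀ k, AEMeasurable (Z k) P) (s : K →₀ ℕ) (c : ℂ) (S : Finset K) (hS : s.support ⊆ S) :
    ∫ ω, MvPolynomial.aeval (fun k => (Z k ω : ℂ)) (MvPolynomial.monomial s c) ∂P =
      c * ∏ k ∈ S, ∫ ω, (Z k ω : ℂ) ^ s k ∂P := by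
  simp only [MvPolynomial.aeval_monomial, Algebra.algebraMap_self, RingHom.id_apply]
  rw [integral_const_mul, ← Finset.prod_coe_sort S]
  congr 1
  have hind' : iIndepFun (fun k : S => Z k) P := hind.precomp Subtype.val_injective
  rw [← hind'.integral_fun_prod_comp (X := fun k : S => Z k)
    (f := fun (k : S) (x : ℝ) => (x : ℂ) ^ s k) (fun k => hm k)
    (fun k => by fun_prop)]
  refine integral_congr_ae (ae_of_all _ fun ω => ?_)
  change (s.prod fun k e => (Z k ω : ℂ) ^ e) = _
  rw [Finsupp.prod_of_support_subset s hS _ (fun _ _ => pow_zero _), ← Finset.prod_coe_sort]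

/-- By linearity f is a monomial. Independence factors its expectation, multiplication by `X k`
changes only the factor of index k, and there the one-dimensional identity applies. -/
theorem polyExp_X_mul [IsProbabilityMeasure P] {K : Type*} {Z : K → Ω → ℝ}
    (hind : iIndepFun Z P) (hG : ∀ k, HasGaussianLaw (Z k) P) (h0 : ∀ k, ∫ ω, Z k ω ∂P = 0)
    (h : ∀ f : MvPolynomial K ℂ,
      Integrable (fun ω => MvPolynomial.aeval (fun k => (Z k ω : ℂ)) f) P)
    (k : K) (f : MvPolynomial K ℂ) :
    polyExp P (fun k ω => (Z k ω : ℂ)) h (MvPolynomial.X k * f) =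
      ((∫ ω, Z k ω ^ 2 ∂P : ℝ) : ℂ) *
        polyExp P (fun k ω => (Z k ω : ℂ)) h (MvPolynomial.pderiv k f) := by
  classical
  induction f using MvPolynomial.induction_on' with
  | add p q hp hq => rw [mul_add, map_add, map_add, map_add, hp, hq, mul_add]
  | monomial s c =>
    rw [MvPolynomial.pderiv_monomial, MvPolynomial.X, MvPolynomial.monomial_mul, one_mul]
    have hm : ∀ k, AEMeasurable (Z k) P := fun k => (hG k).aemeasurable
    have hS : (Finsupp.single k 1 + s).support ⊆ insert k s.support := by
      intro j hj
      by_cases hjk : j = k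
      · simp [hjk]
      · simp [Ne.symm hjk] at hj
        simp [hj]
    have hS' : (s - Finsupp.single k 1).support ⊆ insert k s.support := by
      intro j hj
      simp only [Finsupp.mem_support_iff, Finsupp.tsub_apply] at hj
      rw [Finset.mem_insert, Finsupp.mem_support_iff]
      right
      omega
    change ∫ ω, MvPolynomial.aeval (fun k => (Z k ω : ℂ)) _ ∂P =
      _ * ∫ ω, MvPolynomial.aeval (fun k => (Z k ω : ℂ)) _ ∂P
    rw [integral_monomial_of_iIndepFun hind hm _ _ _ hS,
      integral_monomial_of_iIndepFun hind hm _ _ _ hS']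
    rw [← Finset.mul_prod_erase _ _ (Finset.mem_insert_self k s.support),
      ← Finset.mul_prod_erase _ _ (Finset.mem_insert_self k s.support)]
    have e1 : ∀ j ∈ (insert k s.support).erase k,
        (Finsupp.single k 1 + s : K →₀ ℕ) j = s j ∧ (s - Finsupp.single k 1 : K →₀ ℕ) j = s j := by
      intro j hj
      have : k ≠ j := (Finset.ne_of_mem_erase hj).symm
      simp [this]
    have hp1 : ∏ j ∈ (insert k s.support).erase k,
        ∫ ω, (Z j ω : ℂ) ^ (Finsupp.single k 1 + s : K →₀ ℕ) j ∂P =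
        ∏ j ∈ (insert k s.support).erase k, ∫ ω, (Z j ω : ℂ) ^ s j ∂P :=
      Finset.prod_congr rfl fun j hj => by rw [(e1 j hj).1]
    have hp2 : ∏ j ∈ (insert k s.support).erase k,
        ∫ ω, (Z j ω : ℂ) ^ (s - Finsupp.single k 1 : K →₀ ℕ) j ∂P =
        ∏ j ∈ (insert k s.support).erase k, ∫ ω, (Z j ω : ℂ) ^ s j ∂P :=
      Finset.prod_congr rfl fun j hj => by rw [(e1 j hj).2]
    rw [hp1, hp2]
    have e2 : (Finsupp.single k 1 + s : K →₀ ℕ) k = s k + 1 := by simp [add_comm]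
    have e3 : (s - Finsupp.single k 1 : K →₀ ℕ) k = s k - 1 := by simp
    rw [e2, e3, integral_ofReal_pow_of_hasGaussianLaw (hG k) (h0 k)]
    ring

end GaussianMoments

/-- The chain rule for a substitution all of whose images have partial derivatives of the
form `a ∂ₓ + b ∂_y`. -/
theorem pderiv_aeval_eq {K L R : Type*} [CommRing R] (g : L → MvPolynomial K R) (k : K) (x y : L)
    (a b : R)
    (h : ∀ z, MvPolynomial.pderiv k (g z) =
      MvPolynomial.C a *
          MvPolynomial.aeval g (MvPolynomial.pderiv x (MvPolynomial.X z : MvPolynomial L R)) +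
        MvPolynomial.C b *
          MvPolynomial.aeval g (MvPolynomial.pderiv y (MvPolynomial.X z : MvPolynomial L R)))
    (p : MvPolynomial L R) :
    MvPolynomial.pderiv k (MvPolynomial.aeval g p) =
      MvPolynomial.C a * MvPolynomial.aeval g (MvPolynomial.pderiv x p) +
        MvPolynomial.C b * MvPolynomial.aeval g (MvPolynomial.pderiv y p) := by
  induction p using MvPolynomial.induction_on with
  | C r => simp [MvPolynomial.algebraMap_eq]
  | add p q hp hq => simp only [map_add, hp, hq]; ring
  | mul_X p z hp =>
    simp only [MvPolynomial.pderiv_mul, map_mul, map_add, hp, MvPolynomial.aeval_X, h z]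
    ring

/-! ### Integration by parts for the block ensemble -/

section Ensemble

variable {Ω U : Type*} [MeasurableSpace Ω] {P : Measure Ω} {blk : ∀ n : ℕ, Fin n → Fin 2}
  {V : U → Matrix (Fin 2) (Fin 2) ℝ} {Y : U → ∀ n : ℕ, Ω → Matrix (Fin n) (Fin n) ℂ}

/-- The index set of the real Gaussian variables underlying the ensemble. -/
abbrev GaussIndex (U : Type*) (n : ℕ) := U × {p : Fin n × Fin n // p.1 ≤ p.2} × Bool

/-- The real Gaussian variables underlying the ensemble. -/
def gaussVar (Y : U → ∀ n : ℕ, Ω → Matrix (Fin n) (Fin n) ℂ) (n : ℕ) (k : GaussIndex U n)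
    (ω : Ω) : ℝ :=
  if k.2.2 then (Y k.1 n ω k.2.1.1.1 k.2.1.1.2).re else (Y k.1 n ω k.2.1.1.1 k.2.1.1.2).im

theorem hasGaussianLaw_gaussVar (hY : IsGaussianBlockEnsemble P blk V Y) (n : ℕ)
    (k : GaussIndex U n) : HasGaussianLaw (gaussVar Y n k) P := by
  obtain ⟨u, p, _ | _⟩ := k
  · exact hY.gaussian_im u n p.1.1 p.1.2
  · exact hY.gaussian_re u n p.1.1 p.1.2

theorem integral_gaussVar (hY : IsGaussianBlockEnsemble P blk V Y) (n : ℕ)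
    (k : GaussIndex U n) : ∫ ω, gaussVar Y n k ω ∂P = 0 := by
  obtain ⟨u, p, _ | _⟩ := k
  · exact hY.mean_im u n p.1.1 p.1.2
  · exact hY.mean_re u n p.1.1 p.1.2

/-- The pair of indices on or above the diagonal with the same entries. -/
def sortPair {n : ℕ} (i j : Fin n) : {p : Fin n × Fin n // p.1 ≤ p.2} :=
  ⟨(min i j, max i j), min_le_max⟩

theorem sortPair_eq_iff {n : ℕ} {i j k l : Fin n} :
    sortPair i j = sortPair k l ↔ (i = k ∧ j = l) ∨ (i = l ∧ j = k) := by
  simp only [sortPair, Subtype.mk.injEq, Prod.mk.injEq]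
  grind

/-- The coefficient of the imaginary part in an entry. -/
noncomputable def imCoeff {n : ℕ} (i j : Fin n) : ℂ := if i ≤ j then Complex.I else -Complex.I

theorem imCoeff_mul_self {n : ℕ} (i j : Fin n) : imCoeff i j * imCoeff i j = -1 := by
  unfold imCoeff
  split_ifs <;> simp

theorem imCoeff_swap {n : ℕ} {i j : Fin n} (h : i ≠ j) : imCoeff j i = -imCoeff i j := by
  unfold imCoeff
  split_ifs <;> first | (exfalso; omega) | simp

/-- The entries of the matrices of the ensemble as polynomials in the real variables. -/
noncomputable def entryPoly (U : Type*) (n : ℕ) (z : U × Fin n × Fin n) :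
    MvPolynomial (GaussIndex U n) ℂ :=
  MvPolynomial.X (z.1, sortPair z.2.1 z.2.2, true) +
    MvPolynomial.C (imCoeff z.2.1 z.2.2) * MvPolynomial.X (z.1, sortPair z.2.1 z.2.2, false)

theorem aeval_entryPoly (hY : IsGaussianBlockEnsemble P blk V Y) (n : ℕ) (ω : Ω)
    (z : U × Fin n × Fin n) :
    MvPolynomial.aeval (fun k => (gaussVar Y n k ω : ℂ)) (entryPoly U n z) =
      Y z.1 n ω z.2.1 z.2.2 := by
  obtain ⟨u, i, j⟩ := z
  simp only [entryPoly, map_add, map_mul, MvPolynomial.aeval_X, MvPolynomial.aeval_C, gaussVar,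
    sortPair, Algebra.algebraMap_self, RingHom.id_apply, if_true, Bool.false_eq_true, if_false,
    imCoeff]
  rcases le_or_gt i j with h | h
  · rw [min_eq_left h, max_eq_right h, if_pos h, mul_comm]
    exact Complex.re_add_im _
  · rw [min_eq_right h.le, max_eq_left h.le, if_neg (not_le.2 h), neg_mul, mul_comm Complex.I,
      ← (hY.isHermitian u n ω).apply i j]
    apply Complex.ext <;> simp

theorem aeval_aeval_entryPoly (hY : IsGaussianBlockEnsemble P blk V Y) (n : ℕ) (ω : Ω)
    (f : MvPolynomial (U × Fin n × Fin n) ℂ) :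
    MvPolynomial.aeval (fun k => (gaussVar Y n k ω : ℂ)) (MvPolynomial.aeval (entryPoly U n) f) =
      MvPolynomial.aeval (fun z : U × Fin n × Fin n => Y z.1 n ω z.2.1 z.2.2) f := by
  rw [← AlgHom.comp_apply, MvPolynomial.comp_aeval]
  simp only [aeval_entryPoly hY]

/-- The second moment of the real or imaginary part of an entry. -/
noncomputable def partVar (P : Measure Ω) (Y : U → ∀ n : ℕ, Ω → Matrix (Fin n) (Fin n) ℂ) (u : U)
    {n : ℕ} (i j : Fin n) (b : Bool) : ℝ :=
  ∫ ω, gaussVar Y n (u, sortPair i j, b) ω ^ 2 ∂P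

theorem partVar_nonneg (u : U) {n : ℕ} (i j : Fin n) (b : Bool) : 0 ≤ partVar P Y u i j b :=
  integral_nonneg fun _ => sq_nonneg _

/-- Diagonal entries of a Hermitian matrix are real. -/
theorem partVar_self_false (hY : IsGaussianBlockEnsemble P blk V Y) (u : U) {n : ℕ} (i : Fin n) :
    partVar P Y u i i false = 0 := by
  have h : ∀ ω, gaussVar Y n (u, sortPair i i, false) ω = 0 := fun ω => by
    change (Y u n ω (min i i) (max i i)).im = 0
    rw [min_self, max_self]
    exact Complex.conj_eq_iff_im.1 ((hY.isHermitian u n ω).apply i i)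
  simp [partVar, h]

/-- The pseudo-covariance `E (Y_{i,j}(u)²)` off the diagonal, and zero on it. -/
noncomputable def pseudoCov (P : Measure Ω) (Y : U → ∀ n : ℕ, Ω → Matrix (Fin n) (Fin n) ℂ) (u : U)
    {n : ℕ} (i j : Fin n) : ℝ :=
  if i = j then 0 else partVar P Y u i j true - partVar P Y u i j false

theorem partVar_add (hY : IsGaussianBlockEnsemble P blk V Y) (u : U) {n : ℕ} (i j : Fin n) :
    partVar P Y u i j true + partVar P Y u i j false = V u (blk n i) (blk n j) / n := by
  have hsq : ∀ b, Integrable (fun ω => gaussVar Y n (u, sortPair i j, b) ω ^ 2) P := fun b =>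
    (hasGaussianLaw_gaussVar hY n _).memLp_two.integrable_sq
  rw [partVar, partVar, ← integral_add (hsq true) (hsq false), ← hY.variance u n i j]
  refine integral_congr_ae (ae_of_all _ fun ω => ?_)
  have hn : ∀ z : ℂ, z.re ^ 2 + z.im ^ 2 = ‖z‖ ^ 2 := fun z => by
    rw [Complex.sq_norm, Complex.normSq_apply]; ring
  change (Y u n ω (min i j) (max i j)).re ^ 2 + (Y u n ω (min i j) (max i j)).im ^ 2 = _
  rw [hn]
  change ‖Y u n ω (min i j) (max i j)‖ ^ 2 = ‖Y u n ω i j‖ ^ 2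
  rcases le_or_gt i j with h | h
  · rw [min_eq_left h, max_eq_right h]
  · rw [min_eq_right h.le, max_eq_left h.le, ← (hY.isHermitian u n ω).apply i j]
    exact congrArg (· ^ 2) (norm_star _).symm

/-- The difference of two nonnegative variances is bounded by their sum. Real and imaginary parts
may have different variances, so the pseudo-covariance need not vanish; this bound is what the limit
requires of it. -/
theorem abs_pseudoCov_le (hY : IsGaussianBlockEnsemble P blk V Y) (u : U) {n : ℕ} (i j : Fin n) :
    |pseudoCov P Y u i j| ≤ |V u (blk n i) (blk n j)| / n := by
  have h0 := partVar_nonneg (P := P) (Y := Y) u i j true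
  have h1 := partVar_nonneg (P := P) (Y := Y) u i j false
  have h : |V u (blk n i) (blk n j)| / n =
      partVar P Y u i j true + partVar P Y u i j false := by
    rw [← abs_of_nonneg (add_nonneg h0 h1), partVar_add hY, abs_div, Nat.abs_cast]
  rw [h, pseudoCov]
  split_ifs
  · simpa using add_nonneg h0 h1
  · rw [abs_le]; constructor <;> linarith

variable [IsProbabilityMeasure P]

theorem integrable_gaussVar (hY : IsGaussianBlockEnsemble P blk V Y) (n : ℕ)
    (f : MvPolynomial (GaussIndex U n) ℂ) :
    Integrable (fun ω => MvPolynomial.aeval (fun k => (gaussVar Y n k ω : ℂ)) f) P :=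
  memLp_one_iff_integrable.1 (memLp_aeval (fun k p hp =>
    memLp_ofReal_of_hasGaussianLaw (hasGaussianLaw_gaussVar hY n k) p hp) f 1 (by simp))

theorem integrable_entries (hY : IsGaussianBlockEnsemble P blk V Y) (n : ℕ)
    (f : MvPolynomial (U × Fin n × Fin n) ℂ) :
    Integrable (fun ω => MvPolynomial.aeval
      (fun z : U × Fin n × Fin n => Y z.1 n ω z.2.1 z.2.2) f) P := by
  simp only [← aeval_aeval_entryPoly hY]
  exact integrable_gaussVar hY n _

/-- The expectation of polynomials in the entries of the ensemble. -/
noncomputable def entryExp (hY : IsGaussianBlockEnsemble P blk V Y) (n : ℕ) :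
    MvPolynomial (U × Fin n × Fin n) ℂ →ₗ[ℂ] ℂ :=
  polyExp P (fun z ω => Y z.1 n ω z.2.1 z.2.2) (integrable_entries hY n)

theorem entryExp_apply (hY : IsGaussianBlockEnsemble P blk V Y) (n : ℕ)
    (f : MvPolynomial (U × Fin n × Fin n) ℂ) : entryExp hY n f =
      ∫ ω, MvPolynomial.aeval (fun z : U × Fin n × Fin n => Y z.1 n ω z.2.1 z.2.2) f ∂P := rfl

theorem entryExp_one (hY : IsGaussianBlockEnsemble P blk V Y) (n : ℕ) :
    entryExp hY n 1 = 1 := by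
  rw [entryExp_apply]
  simp

theorem entryExp_eq (hY : IsGaussianBlockEnsemble P blk V Y) (n : ℕ)
    (f : MvPolynomial (U × Fin n × Fin n) ℂ) : entryExp hY n f =
      polyExp P (fun k ω => (gaussVar Y n k ω : ℂ)) (integrable_gaussVar hY n)
        (MvPolynomial.aeval (entryPoly U n) f) := by
  rw [entryExp_apply]
  simp only [← aeval_aeval_entryPoly hY]
  rfl

/-- Gaussian integration by parts for polynomials in the entries. -/
theorem entryExp_X_mul (hY : IsGaussianBlockEnsemble P blk V Y) {n : ℕ} (u : U) (i j : Fin n)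
    (f : MvPolynomial (U × Fin n × Fin n) ℂ) :
    entryExp hY n (MvPolynomial.X (u, i, j) * f) =
      ((V u (blk n i) (blk n j) / n : ℝ) : ℂ) * entryExp hY n (MvPolynomial.pderiv (u, j, i) f) +
        (pseudoCov P Y u i j : ℂ) * entryExp hY n (MvPolynomial.pderiv (u, i, j) f) := by
  classical
  have hX := polyExp_X_mul (Z := gaussVar Y n) (hY.indep n) (hasGaussianLaw_gaussVar hY n)
    (integral_gaussVar hY n) (integrable_gaussVar hY n)
  simp only [entryExp_eq hY]
  rw [map_mul, MvPolynomial.aeval_X, entryPoly, add_mul, map_add, mul_assoc,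
    ← MvPolynomial.smul_eq_C_mul, map_smul, hX, hX, ← partVar_add hY]
  change (partVar P Y u i j true : ℂ) * _ + imCoeff i j • ((partVar P Y u i j false : ℂ) * _) = _
  by_cases hij : i = j
  · subst hij
    -- On the diagonal the real variable occurs in one entry only, so the second direction gets
    -- coefficient 0.
    have h1 := pderiv_aeval_eq (entryPoly U n) (u, sortPair i i, true) (u, i, i) (u, i, i) 1 0
      (fun z => by
        obtain ⟨v, k, l⟩ := z
        simp [entryPoly, MvPolynomial.pderiv_X, Pi.single_apply, sortPair_eq_iff]) f
    rw [h1, partVar_self_false hY, pseudoCov, if_pos rfl]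
    simp
  · have h1 := pderiv_aeval_eq (entryPoly U n) (u, sortPair i j, true) (u, i, j) (u, j, i) 1 1
      (fun z => by
        obtain ⟨v, k, l⟩ := z
        simp [entryPoly, MvPolynomial.pderiv_X, Pi.single_apply, sortPair_eq_iff]
        split_ifs <;> grind) f
    have h2 := pderiv_aeval_eq (entryPoly U n) (u, sortPair i j, false) (u, i, j) (u, j, i)
      (imCoeff i j) (imCoeff j i)
      (fun z => by
        obtain ⟨v, k, l⟩ := z
        simp [entryPoly, MvPolynomial.pderiv_X, Pi.single_apply, sortPair_eq_iff]
        split_ifs <;> grind) f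
    rw [h1, h2, pseudoCov, if_neg hij, imCoeff_swap hij, ← MvPolynomial.smul_eq_C_mul,
      ← MvPolynomial.smul_eq_C_mul, ← MvPolynomial.smul_eq_C_mul, ← MvPolynomial.smul_eq_C_mul,
      map_add, map_add, map_smul, map_smul, map_smul, map_smul]
    simp only [smul_eq_mul]
    push_cast
    -- With c = ±I, c² = -1: the imaginary part contributes with a plus sign to the derivative at
    -- (j, i) and with a minus sign to that at (i, j), which produces variance and pseudo-covariance
    -- respectively.
    linear_combination (partVar P Y u i j false : ℂ) *
      ((polyExp P (fun k ω => (gaussVar Y n k ω : ℂ)) (integrable_gaussVar hY n))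
        ((MvPolynomial.aeval (entryPoly U n)) ((MvPolynomial.pderiv (u, i, j)) f)) -
      (polyExp P (fun k ω => (gaussVar Y n k ω : ℂ)) (integrable_gaussVar hY n))
        ((MvPolynomial.aeval (entryPoly U n)) ((MvPolynomial.pderiv (u, j, i)) f))) *
      imCoeff_mul_self i j

end Ensemble

/-! ### Products of entries of words in the matrices -/

section Words

variable {U : Type*} {n : ℕ}

/-- The matrices `M(u,n)` with the entries of `Y(u,n)` replaced by indeterminates. -/
noncomputable def polyMatrix (bl : Fin n → Fin 2) (α : U → Fin 2 → ℝ) (u : U) :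
    Matrix (Fin n) (Fin n) (MvPolynomial (U × Fin n × Fin n) ℂ) :=
  Matrix.of fun i j => MvPolynomial.X (u, i, j) +
    if i = j then MvPolynomial.C (α u (bl i) : ℂ) else 0

/-- The entry `(i, k)` of the word `w` in the formal matrices, for `t = (w, i, k)`. -/
noncomputable def wordPoly (bl : Fin n → Fin 2) (α : U → Fin 2 → ℝ)
    (t : List U × Fin n × Fin n) : MvPolynomial (U × Fin n × Fin n) ℂ :=
  (t.1.map (polyMatrix bl α)).prod t.2.1 t.2.2

/-- The product of several entries of words. -/
noncomputable def segPoly (bl : Fin n → Fin 2) (α : U → Fin 2 → ℝ)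
    (T : List (List U × Fin n × Fin n)) : MvPolynomial (U × Fin n × Fin n) ℂ :=
  (T.map (wordPoly bl α)).prod

/-- The terms of the partial derivative in the direction `(u, p, q)` of a product of entries of
words: one letter `u` is removed, which cuts the word in which it stands into two. -/
noncomputable def cut (u : U) (p q : Fin n) :
    List (List U × Fin n × Fin n) → List (List (List U × Fin n × Fin n))
  | [] => []
  | t :: T => ((splits u t.1).map fun r => (r.1, t.2.1, p) :: (r.2, q, t.2.2) :: T) ++
      (cut u p q T).map (t :: ·)

/-- The words that occur in `cut`. -/
noncomputable def cutShape (u : U) : List (List U) → List (List (List U))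
  | [] => []
  | w :: S => ((splits u w).map fun r => r.1 :: r.2 :: S) ++ (cutShape u S).map (w :: ·)

/-- Which words arise from a cut does not depend on positions or on n. Hence bounds expressed
through `cutShape` are uniform. -/
theorem map_fst_cut (u : U) (p q : Fin n) (T : List (List U × Fin n × Fin n)) :
    (cut u p q T).map (List.map Prod.fst) = cutShape u (T.map Prod.fst) := by
  induction T with
  | nil => rfl
  | cons t T ih => simp [cut, cutShape, ← ih, Function.comp_def]

theorem map_fst_mem_cutShape {u : U} {p q : Fin n} {T T' : List (List U × Fin n × Fin n)}
    (h : T' ∈ cut u p q T) : T'.map Prod.fst ∈ cutShape u (T.map Prod.fst) := by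
  rw [← map_fst_cut u p q]
  exact List.mem_map_of_mem h

theorem length_cut (u : U) (p q : Fin n) (T : List (List U × Fin n × Fin n)) :
    (cut u p q T).length = (cutShape u (T.map Prod.fst)).length := by
  rw [← map_fst_cut u p q, List.length_map]

/-- The size of a list of words: the number of letters plus the number of words. -/
def shapeSize (S : List (List U)) : ℕ := (S.map fun w => w.length + 1).sum

/-- A cut deletes one letter and creates one more word. Counting words as well as letters makes the
size invariant, so a Schwinger–Dyson step lowers it only through the letter removed beforehand. -/
theorem shapeSize_of_mem_cutShape {u : U} {S S' : List (List U)} (h : S' ∈ cutShape u S) :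
    shapeSize S' = shapeSize S := by
  induction S generalizing S' with
  | nil => simp [cutShape] at h
  | cons w S ih =>
    rw [cutShape, List.mem_append, List.mem_map, List.mem_map] at h
    rcases h with ⟨r, hr, rfl⟩ | ⟨S'', hS, rfl⟩
    · have := length_of_mem_splits hr
      simp only [shapeSize, List.map_cons, List.sum_cons]
      omega
    · have := ih hS
      simp only [shapeSize, List.map_cons, List.sum_cons] at this ⊢
      omega

variable (bl : Fin n → Fin 2) (α : U → Fin 2 → ℝ)

theorem segPoly_cons (t : List U × Fin n × Fin n) (T : List (List U × Fin n × Fin n)) :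
    segPoly bl α (t :: T) = wordPoly bl α t * segPoly bl α T := by
  simp [segPoly]

theorem wordPoly_nil (i k : Fin n) :
    wordPoly bl α (([] : List U), i, k) = if i = k then 1 else 0 := by
  simp [wordPoly, Matrix.one_apply]

theorem wordPoly_cons (u : U) (w : List U) (i k : Fin n) :
    wordPoly bl α (u :: w, i, k) = MvPolynomial.C (α u (bl i) : ℂ) * wordPoly bl α (w, i, k) +
      ∑ l, MvPolynomial.X (u, i, l) * wordPoly bl α (w, l, k) := by
  simp [wordPoly, Matrix.mul_apply, polyMatrix, add_mul, Finset.sum_add_distrib, add_comm]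

/-- Leibniz rule: the derivative of the matrix of u is the matrix unit at (p, q), which splits the
product at that letter. -/
theorem pderiv_wordPoly (u : U) (p q : Fin n) (w : List U) (i k : Fin n) :
    MvPolynomial.pderiv (u, p, q) (wordPoly bl α (w, i, k)) =
      ((splits u w).map fun r =>
        wordPoly bl α (r.1, i, p) * wordPoly bl α (r.2, q, k)).sum := by
  classical
  induction w generalizing i with
  | nil =>
    rw [wordPoly_nil]
    split_ifs <;> simp [splits]
  | cons v w ih =>
    have hsum : ((splits u w).map fun r =>
        wordPoly bl α (v :: r.1, i, p) * wordPoly bl α (r.2, q, k)).sum =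
        MvPolynomial.C (α v (bl i) : ℂ) * ((splits u w).map fun r =>
          wordPoly bl α (r.1, i, p) * wordPoly bl α (r.2, q, k)).sum +
        ∑ l, MvPolynomial.X (v, i, l) * ((splits u w).map fun r =>
          wordPoly bl α (r.1, l, p) * wordPoly bl α (r.2, q, k)).sum := by
      induction splits u w with
      | nil => simp
      | cons r L ihL =>
        rw [List.map_cons, List.sum_cons, ihL]
        simp only [List.map_cons, List.sum_cons, wordPoly_cons, mul_add, add_mul,
          Finset.sum_add_distrib, Finset.sum_mul, mul_assoc]
        ring
    rw [wordPoly_cons, map_add, MvPolynomial.pderiv_C_mul, map_sum, ih]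
    simp only [MvPolynomial.pderiv_mul, ih, Finset.sum_add_distrib]
    rw [add_left_comm, ← hsum]
    by_cases h : v = u
    · subst h
      rw [splits_cons_self, List.map_cons, List.sum_cons, List.map_map, wordPoly_nil]
      congr 1
      by_cases hip : i = p
      · subst hip
        simp [MvPolynomial.pderiv_X, Pi.single_apply]
      · simp [MvPolynomial.pderiv_X, hip]
    · rw [splits_cons_of_ne h, List.map_map]
      simp [MvPolynomial.pderiv_X, h, Function.comp_def]

theorem pderiv_segPoly (u : U) (p q : Fin n) (T : List (List U × Fin n × Fin n)) :
    MvPolynomial.pderiv (u, p, q) (segPoly bl α T) = ((cut u p q T).map (segPoly bl α)).sum := by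
  induction T with
  | nil => simp [segPoly, cut]
  | cons t T ih =>
    obtain ⟨w, i, k⟩ := t
    rw [segPoly_cons, MvPolynomial.pderiv_mul, ih, pderiv_wordPoly]
    simp only [cut, List.map_append, List.sum_append, List.map_map, Function.comp_def,
      segPoly_cons, ← List.sum_map_mul_left, ← List.sum_map_mul_right, mul_assoc]

end Words

/-! ### The limits of products of entries -/

section Limits

variable {U : Type*} {n : ℕ} (m : Fin 2 → List U → ℂ) (bl : Fin n → Fin 2)

/-- The limit of the entry `(i, k)` of a word, given the limit moments `m`. -/
noncomputable def entLim (t : List U × Fin n × Fin n) : ℂ :=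
  if t.2.1 = t.2.2 then m (bl t.2.1) t.1 else 0

/-- The limit of a product of entries of words. -/
noncomputable def segLim (T : List (List U × Fin n × Fin n)) : ℂ := (T.map (entLim m bl)).prod

/-- A bound for the limits of the entries of a word. -/
noncomputable def wordBound (w : List U) : ℝ := ‖m 0 w‖ + ‖m 1 w‖

/-- A bound for the limits of the products of entries of words. -/
noncomputable def shapeBound (S : List (List U)) : ℝ := (S.map (wordBound m)).prod

/-- A bound for the sum of the limits over `cut`. -/
noncomputable def cutBound (u : U) (S : List (List U)) : ℝ :=
  ((cutShape u S).map (shapeBound m)).sum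

theorem segLim_cons (t : List U × Fin n × Fin n) (T : List (List U × Fin n × Fin n)) :
    segLim m bl (t :: T) = entLim m bl t * segLim m bl T := by
  simp [segLim]

theorem wordBound_nonneg (w : List U) : 0 ≤ wordBound m w := by
  unfold wordBound; positivity

theorem norm_le_wordBound (q : Fin 2) (w : List U) : ‖m q w‖ ≤ wordBound m w := by
  unfold wordBound
  fin_cases q
  · exact le_add_of_nonneg_right (norm_nonneg _)
  · exact le_add_of_nonneg_left (norm_nonneg _)

theorem norm_entLim_le (t : List U × Fin n × Fin n) : ‖entLim m bl t‖ ≤ wordBound m t.1 := by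
  unfold entLim
  split_ifs
  · exact norm_le_wordBound m _ _
  · rw [norm_zero]; exact wordBound_nonneg m _

theorem shapeBound_cons (w : List U) (S : List (List U)) :
    shapeBound m (w :: S) = wordBound m w * shapeBound m S := by
  simp [shapeBound]

theorem shapeBound_nonneg (S : List (List U)) : 0 ≤ shapeBound m S := by
  induction S with
  | nil => simp [shapeBound]
  | cons w S ih => rw [shapeBound_cons]; exact mul_nonneg (wordBound_nonneg m w) ih

theorem norm_segLim_le (T : List (List U × Fin n × Fin n)) :
    ‖segLim m bl T‖ ≤ shapeBound m (T.map Prod.fst) := by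
  induction T with
  | nil => simp [segLim, shapeBound]
  | cons t T ih =>
    rw [segLim_cons, List.map_cons, shapeBound_cons, norm_mul]
    exact mul_le_mul (norm_entLim_le m bl t) ih (norm_nonneg _) (wordBound_nonneg m _)

theorem norm_list_sum_map_le {ι : Type*} (l : List ι) (f : ι → ℂ) (g : ι → ℝ)
    (h : ∀ x ∈ l, ‖f x‖ ≤ g x) : ‖(l.map f).sum‖ ≤ (l.map g).sum := by
  induction l with
  | nil => simp
  | cons x l ih =>
    rw [List.map_cons, List.map_cons, List.sum_cons, List.sum_cons]
    exact (norm_add_le _ _).trans (add_le_add (h x (by simp))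
      (ih fun y hy => h y (List.mem_cons_of_mem _ hy)))

theorem list_sum_map_nonneg {ι : Type*} (l : List ι) (g : ι → ℝ) (h : ∀ x ∈ l, 0 ≤ g x) :
    0 ≤ (l.map g).sum :=
  List.sum_nonneg fun y hy => by
    obtain ⟨x, hx, rfl⟩ := List.mem_map.1 hy
    exact h x hx

theorem cutBound_nonneg (u : U) (S : List (List U)) : 0 ≤ cutBound m u S :=
  list_sum_map_nonneg _ _ fun _ _ => shapeBound_nonneg m _

theorem norm_sum_cut_le (u : U) (p q : Fin n) (T : List (List U × Fin n × Fin n)) :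
    ‖((cut u p q T).map (segLim m bl)).sum‖ ≤ cutBound m u (T.map Prod.fst) := by
  rw [cutBound, ← map_fst_cut u p q, List.map_map]
  exact norm_list_sum_map_le _ _ _ fun T' _ => norm_segLim_le m bl T'

theorem cutBound_cons (u : U) (w : List U) (S : List (List U)) :
    cutBound m u (w :: S) =
      ((splits u w).map fun r => wordBound m r.1 * (wordBound m r.2 * shapeBound m S)).sum +
        wordBound m w * cutBound m u S := by
  simp only [cutBound, cutShape, List.map_append, List.sum_append, List.map_map,
    Function.comp_def, shapeBound_cons, List.sum_map_mul_left]

/-- The sum over `cut u p q`, when the first word starts in row `l`. -/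
theorem sum_cut_cons (u : U) (p q l k : Fin n) (w : List U) (T : List (List U × Fin n × Fin n)) :
    ((cut u p q ((w, l, k) :: T)).map (segLim m bl)).sum =
      ((splits u w).map fun r =>
        entLim m bl (r.1, l, p) * (entLim m bl (r.2, q, k) * segLim m bl T)).sum +
      entLim m bl (w, l, k) * ((cut u p q T).map (segLim m bl)).sum := by
  simp only [cut, List.map_append, List.sum_append, List.map_map, Function.comp_def,
    segLim_cons, List.sum_map_mul_left]

/-- The leading part of the sum over `cut`, when the row `l` belongs to the block `p`. -/
noncomputable def mainSum (u : U) (w : List U) (i k : Fin n) (T : List (List U × Fin n × Fin n))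
    (p : Fin 2) : ℂ :=
  ((splits u w).map fun r => m p r.1 * (entLim m bl (r.2, i, k) * segLim m bl T)).sum

theorem norm_mainSum_le (u : U) (w : List U) (i k : Fin n)
    (T : List (List U × Fin n × Fin n)) (p : Fin 2) :
    ‖mainSum m bl u w i k T p‖ ≤ cutBound m u (w :: T.map Prod.fst) := by
  rw [cutBound_cons]
  refine le_add_of_le_of_nonneg (norm_list_sum_map_le _ _ _ fun r _ => ?_)
    (mul_nonneg (wordBound_nonneg m w) (cutBound_nonneg m u _))
  rw [norm_mul, norm_mul]
  exact mul_le_mul (norm_le_wordBound m _ _) (mul_le_mul (norm_entLim_le m bl _)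
    (norm_segLim_le m bl T) (norm_nonneg _) (wordBound_nonneg m _)) (by positivity)
    (wordBound_nonneg m _)

/-- Cuts inside w leave a first piece on the diagonal position (l, l) and give the main sum exactly.
Cuts inside T keep the factor at (l, k), whose limit vanishes unless l = k. -/
theorem norm_sum_cut_sub_mainSum_le (u : U) (w : List U) (i k l : Fin n)
    (T : List (List U × Fin n × Fin n)) :
    ‖((cut u l i ((w, l, k) :: T)).map (segLim m bl)).sum - mainSum m bl u w i k T (bl l)‖ ≤
      cutBound m u (w :: T.map Prod.fst) * if l = k then 1 else 0 := by
  have h : ((cut u l i ((w, l, k) :: T)).map (segLim m bl)).sum - mainSum m bl u w i k T (bl l) =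
      entLim m bl (w, l, k) * ((cut u l i T).map (segLim m bl)).sum := by
    rw [sum_cut_cons, mainSum]
    simp [entLim]
  rw [h]
  by_cases hlk : l = k
  · rw [if_pos hlk, mul_one, cutBound_cons, norm_mul]
    exact le_add_of_nonneg_of_le (list_sum_map_nonneg _ _ fun r _ =>
      mul_nonneg (wordBound_nonneg m _) (mul_nonneg (wordBound_nonneg m _) (shapeBound_nonneg m _)))
      (mul_le_mul (norm_entLim_le m bl _) (norm_sum_cut_le m bl u l i T) (norm_nonneg _)
        (wordBound_nonneg m _))
  · simp [entLim, hlk]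

/-- In the pseudo-covariance term a cut of w puts the first piece at (l, i), and a cut of T keeps
the factor at (l, k). Only l = i or l = k can contribute in the limit, hence at most two values of
l. -/
theorem norm_sum_cut_swap_le (u : U) (w : List U) (i k l : Fin n)
    (T : List (List U × Fin n × Fin n)) :
    ‖((cut u i l ((w, l, k) :: T)).map (segLim m bl)).sum‖ ≤
      cutBound m u (w :: T.map Prod.fst) * ((if l = i then 1 else 0) + if l = k then 1 else 0) := by
  have h := norm_sum_cut_le m bl u i l ((w, l, k) :: T)
  have h0 := cutBound_nonneg m u (w :: T.map Prod.fst)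
  rw [List.map_cons] at h
  by_cases hi : l = i
  · refine h.trans (le_mul_of_one_le_right h0 ?_)
    rw [if_pos hi]
    split_ifs <;> norm_num
  by_cases hk : l = k
  · refine h.trans (le_mul_of_one_le_right h0 ?_)
    rw [if_pos hk, if_neg hi, zero_add]
  rw [sum_cut_cons]
  simp [entLim, hi, hk]

end Limits

/-! ### Asymptotic solution of the Schwinger–Dyson equation. -/

section Asymptotics

variable {Ω U : Type*} [MeasurableSpace Ω] {P : Measure Ω} [IsProbabilityMeasure P]
  {blk : ∀ n : ℕ, Fin n → Fin 2} {V : U → Matrix (Fin 2) (Fin 2) ℝ}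
  {Y : U → ∀ n : ℕ, Ω → Matrix (Fin n) (Fin n) ℂ}

/-- The expectation of a product of entries of words in the matrices `M(u,n)`. -/
noncomputable def segExp (hY : IsGaussianBlockEnsemble P blk V Y) (α : U → Fin 2 → ℝ) (n : ℕ)
    (T : List (List U × Fin n × Fin n)) : ℂ :=
  entryExp hY n (segPoly (blk n) α T)

theorem segExp_nil (hY : IsGaussianBlockEnsemble P blk V Y) (α : U → Fin 2 → ℝ) (n : ℕ) :
    segExp hY α n [] = 1 :=
  entryExp_one hY n

theorem segExp_cons_nil (hY : IsGaussianBlockEnsemble P blk V Y) (α : U → Fin 2 → ℝ) (n : ℕ)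
    (i k : Fin n) (T : List (List U × Fin n × Fin n)) :
    segExp hY α n (([], i, k) :: T) = if i = k then segExp hY α n T else 0 := by
  unfold segExp
  rw [segPoly_cons, wordPoly_nil]
  split_ifs <;> simp

/-- The Schwinger–Dyson equation for products of entries of words. -/
theorem segExp_cons_cons (hY : IsGaussianBlockEnsemble P blk V Y) (α : U → Fin 2 → ℝ) (n : ℕ)
    (u : U) (w : List U) (i k : Fin n) (T : List (List U × Fin n × Fin n)) :
    segExp hY α n ((u :: w, i, k) :: T) = α u (blk n i) * segExp hY α n ((w, i, k) :: T) +
      ∑ l, (((V u (blk n i) (blk n l) / n : ℝ) : ℂ) *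
          ((cut u l i ((w, l, k) :: T)).map (segExp hY α n)).sum +
        (pseudoCov P Y u i l : ℂ) * ((cut u i l ((w, l, k) :: T)).map (segExp hY α n)).sum) := by
  have hsum : ∀ L : List (List (List U × Fin n × Fin n)),
      (L.map (segExp hY α n)).sum = entryExp hY n (L.map (segPoly (blk n) α)).sum := fun L => by
    rw [map_list_sum, List.map_map]
    rfl
  simp only [hsum]
  unfold segExp
  rw [segPoly_cons, wordPoly_cons, add_mul, map_add, mul_assoc, ← segPoly_cons,
    ← MvPolynomial.smul_eq_C_mul, map_smul, smul_eq_mul, Finset.sum_mul, map_sum]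
  congr 1
  refine Finset.sum_congr rfl fun l _ => ?_
  rw [mul_assoc, ← segPoly_cons, entryExp_X_mul, pderiv_segPoly, pderiv_segPoly]

theorem norm_sum_cut_sub_le {n : ℕ} {L : List (List (List U × Fin n × Fin n))}
    {f g : List (List U × Fin n × Fin n) → ℂ} {δ : ℝ} (h : ∀ T ∈ L, ‖f T - g T‖ ≤ δ) :
    ‖(L.map f).sum - (L.map g).sum‖ ≤ L.length * δ := by
  induction L with
  | nil => simp
  | cons T L ih =>
    have h1 := h T (by simp)
    have h2 := ih fun T' hT' => h T' (List.mem_cons_of_mem _ hT')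
    simp only [List.map_cons, List.sum_cons, List.length_cons]
    rw [add_sub_add_comm]
    refine (norm_add_le _ _).trans ?_
    push_cast
    linarith

/-- A bound for the entries of a variance matrix. -/
noncomputable def varBound (V : U → Matrix (Fin 2) (Fin 2) ℝ) (u : U) : ℝ := ∑ p, ∑ q, |V u p q|

theorem varBound_nonneg (V : U → Matrix (Fin 2) (Fin 2) ℝ) (u : U) : 0 ≤ varBound V u :=
  Finset.sum_nonneg fun _ _ => Finset.sum_nonneg fun _ _ => abs_nonneg _

theorem abs_le_varBound (V : U → Matrix (Fin 2) (Fin 2) ℝ) (u : U) (p q : Fin 2) :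
    |V u p q| ≤ varBound V u :=
  (Finset.single_le_sum (f := fun q => |V u p q|) (fun _ _ => abs_nonneg _)
    (Finset.mem_univ q)).trans
    (Finset.single_le_sum (f := fun p => ∑ q, |V u p q|)
      (fun _ _ => Finset.sum_nonneg fun _ _ => abs_nonneg _) (Finset.mem_univ p))

/-- The proportion of the indices that belong to a block. -/
noncomputable def blockRatio (blk : ∀ n : ℕ, Fin n → Fin 2) (q : Fin 2) (n : ℕ) : ℝ :=
  ((Finset.univ.filter fun i => blk n i = q).card : ℝ) / n

theorem sum_div_blk (blk : ∀ n : ℕ, Fin n → Fin 2) (n : ℕ) (f : Fin 2 → ℂ) :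
    ∑ l, f (blk n l) / n = blockRatio blk 0 n * f 0 + blockRatio blk 1 n * f 1 := by
  have h : ∀ l, f (blk n l) / n = ∑ q, if blk n l = q then f q / n else 0 := fun l => by simp
  simp only [h]
  rw [Finset.sum_comm]
  simp only [Finset.sum_ite, Finset.sum_const_zero, add_zero, Finset.sum_const, nsmul_eq_mul,
    Fin.sum_univ_two, blockRatio]
  push_cast
  ring

theorem sum_const_div_le {n : ℕ} (c : ℝ) (hc : 0 ≤ c) : ∑ _l : Fin n, c / n ≤ c := by
  rw [Finset.sum_const, Finset.card_univ, Fintype.card_fin, nsmul_eq_mul]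
  rcases Nat.eq_zero_or_pos n with rfl | hn
  · simpa using hc
  · have : (n : ℝ) ≠ 0 := by positivity
    rw [mul_div_cancel₀ _ this]

/-- The error in one step of the induction on the number of letters. -/
theorem norm_segExp_sub_segLim_le (hY : IsGaussianBlockEnsemble P blk V Y) (α : U → Fin 2 → ℝ)
    (m : Fin 2 → List U → ℂ) {u : U} {w : List U}
    (hm : ∀ q, m q (u :: w) = α u q * m q w +
      V u 1 q * ((splits u w).map fun r => m 1 r.1 * m q r.2).sum)
    {n : ℕ} (i k : Fin n) (T : List (List U × Fin n × Fin n)) {δ : ℝ}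
    (h0 : ‖segExp hY α n ((w, i, k) :: T) - segLim m (blk n) ((w, i, k) :: T)‖ ≤ δ)
    (h1 : ∀ T' : List (List U × Fin n × Fin n),
      T'.map Prod.fst ∈ cutShape u (w :: T.map Prod.fst) →
      ‖segExp hY α n T' - segLim m (blk n) T'‖ ≤ δ) :
    ‖segExp hY α n ((u :: w, i, k) :: T) - segLim m (blk n) ((u :: w, i, k) :: T)‖ ≤
      (|α u 0| + |α u 1| + 2 * varBound V u * (cutShape u (w :: T.map Prod.fst)).length) * δ +
      varBound V u * cutBound m u (w :: T.map Prod.fst) *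
        (3 / n + blockRatio blk 0 n + |blockRatio blk 1 n - 1|) := by
  set S := w :: T.map Prod.fst with hS
  set r : ℝ := ((cutShape u S).length : ℝ) with hr
  set D := cutBound m u S with hD
  set B := varBound V u with hB
  have hδ : 0 ≤ δ := (norm_nonneg _).trans h0
  have hB0 : 0 ≤ B := varBound_nonneg V u
  have hD0 : 0 ≤ D := cutBound_nonneg m u S
  have hn : 0 < (n : ℝ) := by exact_mod_cast Fin.pos i
  set s : Fin n → ℂ := fun l => ((V u (blk n i) (blk n l) / n : ℝ) : ℂ) with hs
  set c : Fin n → ℂ := fun l => (pseudoCov P Y u i l : ℂ) with hc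
  have hs_le : ∀ l, ‖s l‖ ≤ B / n := fun l => by
    rw [hs, Complex.norm_real, Real.norm_eq_abs, abs_div, Nat.abs_cast]
    gcongr
    exact abs_le_varBound V u _ _
  have hc_le : ∀ l, ‖c l‖ ≤ B / n := fun l => by
    rw [hc, Complex.norm_real, Real.norm_eq_abs]
    refine (abs_pseudoCov_le hY u i l).trans ?_
    gcongr
    exact abs_le_varBound V u _ _
  set E₁ : Fin n → ℂ := fun l => ((cut u l i ((w, l, k) :: T)).map (segExp hY α n)).sum with hE₁
  set E₂ : Fin n → ℂ := fun l => ((cut u i l ((w, l, k) :: T)).map (segExp hY α n)).sum with hE₂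
  set L₁ : Fin n → ℂ := fun l => ((cut u l i ((w, l, k) :: T)).map (segLim m (blk n))).sum with hL₁
  set L₂ : Fin n → ℂ := fun l => ((cut u i l ((w, l, k) :: T)).map (segLim m (blk n))).sum with hL₂
  set F : Fin 2 → ℂ := mainSum m (blk n) u w i k T with hF
  have hEL₁ : ∀ l, ‖E₁ l - L₁ l‖ ≤ r * δ := fun l => by
    have := norm_sum_cut_sub_le (L := cut u l i ((w, l, k) :: T)) (f := segExp hY α n)
      (g := segLim m (blk n)) (δ := δ) fun T' hT' => h1 T' (map_fst_mem_cutShape hT')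
    rwa [length_cut] at this
  have hEL₂ : ∀ l, ‖E₂ l - L₂ l‖ ≤ r * δ := fun l => by
    have := norm_sum_cut_sub_le (L := cut u i l ((w, l, k) :: T)) (f := segExp hY α n)
      (g := segLim m (blk n)) (δ := δ) fun T' hT' => h1 T' (map_fst_mem_cutShape hT')
    rwa [length_cut] at this
  have hLF : ∀ l, ‖L₁ l - F (blk n l)‖ ≤ D * if l = k then 1 else 0 := fun l =>
    norm_sum_cut_sub_mainSum_le m (blk n) u w i k l T
  have hL₂0 : ∀ l, ‖L₂ l‖ ≤ D * ((if l = i then 1 else 0) + if l = k then 1 else 0) := fun l =>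
    norm_sum_cut_swap_le m (blk n) u w i k l T
  have hF_le : ∀ p, ‖F p‖ ≤ D := fun p => norm_mainSum_le m (blk n) u w i k T p
  -- Symmetry of V turns the coefficient v_{2,q} of the recursion into v_{q,2}, the one produced by
  -- averaging l over the second block.
  have hlim : segLim m (blk n) ((u :: w, i, k) :: T) =
      α u (blk n i) * segLim m (blk n) ((w, i, k) :: T) + V u (blk n i) 1 * F 1 := by
    rw [segLim_cons, segLim_cons, hF, mainSum, (hY.symm u).apply 1 (blk n i)]
    by_cases hik : i = k
    · simp only [entLim, if_pos hik, hm, ← mul_assoc, List.sum_map_mul_right]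
      ring
    · simp [entLim, hik]
  have hmain : ∑ l, s l * F (blk n l) = blockRatio blk 0 n * (V u (blk n i) 0 * F 0) +
      blockRatio blk 1 n * (V u (blk n i) 1 * F 1) := by
    rw [← sum_div_blk blk n fun p => (V u (blk n i) p : ℂ) * F p]
    refine Finset.sum_congr rfl fun l _ => ?_
    simp only [hs]
    push_cast
    ring
  -- Errors in order: the deterministic diagonal part, two inductive errors, coincidences l = k in
  -- the variance term, the whole pseudo-covariance limit, and the deviation of the block
  -- proportions from 0 and 1. The coincidences give the constant 3 in 3/n, namely 1 + 2.
  have hdecomp : segExp hY α n ((u :: w, i, k) :: T) - segLim m (blk n) ((u :: w, i, k) :: T) =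
      α u (blk n i) * (segExp hY α n ((w, i, k) :: T) - segLim m (blk n) ((w, i, k) :: T)) +
      ∑ l, s l * (E₁ l - L₁ l) + ∑ l, c l * (E₂ l - L₂ l) +
      ∑ l, s l * (L₁ l - F (blk n l)) + ∑ l, c l * L₂ l +
      (blockRatio blk 0 n * (V u (blk n i) 0 * F 0) +
        (blockRatio blk 1 n - 1) * (V u (blk n i) 1 * F 1)) := by
    rw [segExp_cons_cons, hlim]
    have e : ∑ l, (s l * E₁ l + c l * E₂ l) = ∑ l, s l * (E₁ l - L₁ l) + ∑ l, c l * (E₂ l - L₂ l) +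
        ∑ l, s l * (L₁ l - F (blk n l)) + ∑ l, c l * L₂ l + ∑ l, s l * F (blk n l) := by
      simp only [← Finset.sum_add_distrib]
      exact Finset.sum_congr rfl fun l _ => by ring
    have e' := e
    rw [hmain] at e'
    linear_combination e'
  have hα : ‖(α u (blk n i) : ℂ)‖ ≤ |α u 0| + |α u 1| := by
    rw [Complex.norm_real, Real.norm_eq_abs]
    rcases Fin.exists_fin_two.1 ⟨blk n i, rfl⟩ with h | h
    · rw [← h]; exact le_add_of_nonneg_right (abs_nonneg _)
    · rw [← h]; exact le_add_of_nonneg_left (abs_nonneg _)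
  have hbd : ∀ (a x : Fin n → ℂ), (∀ l, ‖a l‖ ≤ B / n) → (∀ l, ‖x l‖ ≤ r * δ) →
      ‖∑ l, a l * x l‖ ≤ B * (r * δ) := fun a x ha hx => by
    refine (norm_sum_le _ _).trans (le_trans (Finset.sum_le_sum fun l _ => ?_)
      (sum_const_div_le (n := n) (B * (r * δ)) (by positivity)))
    rw [norm_mul, mul_div_right_comm]
    exact mul_le_mul (ha l) (hx l) (norm_nonneg _) (by positivity)
  have t1 : ‖(α u (blk n i) : ℂ) * (segExp hY α n ((w, i, k) :: T) -
      segLim m (blk n) ((w, i, k) :: T))‖ ≤ (|α u 0| + |α u 1|) * δ := by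
    rw [norm_mul]
    exact mul_le_mul hα h0 (norm_nonneg _) (by positivity)
  have t4 : ‖∑ l, s l * (L₁ l - F (blk n l))‖ ≤ B / n * D := by
    refine (norm_sum_le _ _).trans (le_trans (Finset.sum_le_sum
      (g := fun l => B / n * (D * if l = k then 1 else 0)) fun l _ => ?_) ?_)
    · rw [norm_mul]
      exact mul_le_mul (hs_le l) (hLF l) (norm_nonneg _) (by positivity)
    · simp
  have t5 : ‖∑ l, c l * L₂ l‖ ≤ B / n * (D * 2) := by
    refine (norm_sum_le _ _).trans (le_trans (Finset.sum_le_sum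
      (g := fun l => B / n * (D * ((if l = i then 1 else 0) + if l = k then 1 else 0)))
      fun l _ => ?_) ?_)
    · rw [norm_mul]
      exact mul_le_mul (hc_le l) (hL₂0 l) (norm_nonneg _) (by positivity)
    · simp only [← Finset.mul_sum, Finset.sum_add_distrib]
      simp [one_add_one_eq_two]
  have hVF : ∀ p, ‖(V u (blk n i) p : ℂ) * F p‖ ≤ B * D := fun p => by
    rw [norm_mul, Complex.norm_real, Real.norm_eq_abs]
    exact mul_le_mul (abs_le_varBound V u _ _) (hF_le p) (norm_nonneg _) hB0
  have t6 : ‖(blockRatio blk 0 n : ℂ) * (V u (blk n i) 0 * F 0)‖ ≤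
      blockRatio blk 0 n * (B * D) := by
    have hρ : 0 ≤ blockRatio blk 0 n := by unfold blockRatio; positivity
    rw [norm_mul, Complex.norm_real, Real.norm_of_nonneg hρ]
    exact mul_le_mul_of_nonneg_left (hVF 0) hρ
  have t7 : ‖((blockRatio blk 1 n : ℂ) - 1) * (V u (blk n i) 1 * F 1)‖ ≤
      |blockRatio blk 1 n - 1| * (B * D) := by
    rw [norm_mul, ← Complex.ofReal_one, ← Complex.ofReal_sub, Complex.norm_real, Real.norm_eq_abs]
    exact mul_le_mul_of_nonneg_left (hVF 1) (abs_nonneg _)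
  rw [hdecomp]
  calc _ ≤ (|α u 0| + |α u 1|) * δ + B * (r * δ) + B * (r * δ) + B / n * D + B / n * (D * 2) +
        (blockRatio blk 0 n * (B * D) + |blockRatio blk 1 n - 1| * (B * D)) :=
      norm_add_le_of_le (norm_add_le_of_le (norm_add_le_of_le (norm_add_le_of_le
        (norm_add_le_of_le t1 (hbd _ _ hs_le hEL₁)) (hbd _ _ hc_le hEL₂)) t4) t5)
        (norm_add_le_of_le t6 t7)
    _ = _ := by ring

/-- The expectations of products of entries of words converge, uniformly in the positions of the
entries. -/
theorem eventually_norm_segExp_sub_segLim_le (hY : IsGaussianBlockEnsemble P blk V Y)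
    (α : U → Fin 2 → ℝ) (m : Fin 2 → List U → ℂ) (hm0 : ∀ q, m q [] = 1)
    (hm : ∀ q u w, m q (u :: w) = α u q * m q w +
      V u 1 q * ((splits u w).map fun r => m 1 r.1 * m q r.2).sum)
    (S : List (List U)) {ε : ℝ} (hε : 0 < ε) :
    ∀ᶠ n in atTop, ∀ T : List (List U × Fin n × Fin n), T.map Prod.fst = S →
      ‖segExp hY α n T - segLim m (blk n) T‖ ≤ ε := by
  induction hN : shapeSize S using Nat.strong_induction_on generalizing S ε with
  | _ N ih =>
  subst hN
  rcases S with _ | ⟨_ | ⟨u, w⟩, S⟩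
  · refine Eventually.of_forall fun n T hT => ?_
    rw [List.map_eq_nil_iff] at hT
    subst hT
    rw [segExp_nil]
    simpa [segLim] using hε.le
  -- An empty word is a Kronecker delta and can be dropped; the size decreases since it counts
  -- words.
  · filter_upwards [ih (shapeSize S) (by simp [shapeSize]) S hε rfl] with n hn T hT
    rcases T with _ | ⟨⟨w, i, k⟩, T⟩
    · simp at hT
    simp only [List.map_cons, List.cons.injEq] at hT
    obtain ⟨rfl, hT⟩ := hT
    rw [segExp_cons_nil, segLim_cons]
    by_cases hik : i = k
    · simpa [entLim, hik, hm0] using hn T hT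
    · simpa [entLim, hik] using hε.le
  · set a : ℝ := |α u 0| + |α u 1| + 2 * varBound V u * (cutShape u (w :: S)).length with ha
    have ha0 : 0 ≤ a := by
      have := varBound_nonneg V u
      positivity
    -- Chosen so that a δ ≤ ε / 2; adding 1 to a keeps the denominator positive when a = 0.
    set δ : ℝ := ε / (2 * (a + 1)) with hδ
    have hδ0 : 0 < δ := by positivity
    have hsz : shapeSize (w :: S) < shapeSize ((u :: w) :: S) := by simp [shapeSize]
    have e0 := ih _ hsz (w :: S) hδ0 rfl
    -- Only finitely many shapes arise, independently of n, so the eventual bounds can be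
    -- intersected.
    have e1 : ∀ᶠ n in atTop, ∀ S' ∈ cutShape u (w :: S),
        ∀ T : List (List U × Fin n × Fin n), T.map Prod.fst = S' →
          ‖segExp hY α n T - segLim m (blk n) T‖ ≤ δ := by
      refine ((cutShape u (w :: S)).finite_toSet.eventually_all).2 fun S' hS' => ?_
      exact ih _ (by rw [shapeSize_of_mem_cutShape hS']; exact hsz) S' hδ0 rfl
    have e2 : ∀ᶠ n : ℕ in atTop, varBound V u * cutBound m u (w :: S) *
        (3 / n + blockRatio blk 0 n + |blockRatio blk 1 n - 1|) ≤ ε / 2 := by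
      have h3 : Tendsto (fun n : ℕ => (3 : ℝ) / n) atTop (𝓝 0) :=
        tendsto_const_div_atTop_nhds_zero_nat 3
      have hd1 : Tendsto (fun n => blockRatio blk 0 n) atTop (𝓝 0) := hY.dim₁
      have hd2 : Tendsto (fun n => blockRatio blk 1 n) atTop (𝓝 1) := hY.dim₂
      have := ((h3.add hd1).add (hd2.sub_const 1).abs).const_mul
        (varBound V u * cutBound m u (w :: S))
      simp only [sub_self, abs_zero, add_zero, mul_zero] at this
      exact this.eventually_le_const (by positivity)
    filter_upwards [e0, e1, e2] with n h0 h1 h2 T hT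
    rcases T with _ | ⟨⟨w', i, k⟩, T⟩
    · simp at hT
    simp only [List.map_cons, List.cons.injEq] at hT
    obtain ⟨rfl, rfl⟩ := hT
    refine (norm_segExp_sub_segLim_le hY α m (fun q => hm q u w) i k T (h0 ((w, i, k) :: T) rfl)
      fun T' hT' => h1 _ hT' T' rfl).trans ?_
    have h4 : a * δ ≤ ε / 2 := by
      rw [hδ, mul_div_assoc', div_le_div_iff₀ (by positivity) (by positivity)]
      nlinarith
    linarith

end Asymptotics

/-- Noncommutative polynomials in the random matrices are evaluations of noncommutative polynomials
in the formal matrices. -/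
theorem lift_meixnerMatrix {Ω U : Type*} (blk : ∀ n : ℕ, Fin n → Fin 2) (α : U → Fin 2 → ℝ)
    (Y : U → ∀ n : ℕ, Ω → Matrix (Fin n) (Fin n) ℂ) (n : ℕ) (ω : Ω) (p : FreeAlgebra ℂ U)
    (i j : Fin n) :
    FreeAlgebra.lift ℂ (fun u => meixnerMatrix blk α Y u n ω) p i j =
      MvPolynomial.aeval (fun z : U × Fin n × Fin n => Y z.1 n ω z.2.1 z.2.2)
        (FreeAlgebra.lift ℂ (polyMatrix (blk n) α) p i j) := by
  have h : FreeAlgebra.lift ℂ (fun u => meixnerMatrix blk α Y u n ω) =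
      (MvPolynomial.aeval (R := ℂ)
        (fun z : U × Fin n × Fin n => Y z.1 n ω z.2.1 z.2.2)).mapMatrix.comp
        (FreeAlgebra.lift ℂ (polyMatrix (blk n) α)) := by
    refine FreeAlgebra.hom_ext (funext fun u => ?_)
    ext i j
    simp only [Function.comp_apply, FreeAlgebra.lift_ι_apply, AlgHom.comp_apply,
      AlgHom.mapMatrix_apply, Matrix.map_apply, polyMatrix, Matrix.of_apply, map_add,
      MvPolynomial.aeval_X, meixnerMatrix, blockUnit, Matrix.add_apply, Matrix.smul_apply,
      Matrix.diagonal_apply, smul_eq_mul, add_assoc]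
    by_cases hij : i = j
    · subst hij
      rcases Fin.exists_fin_two.1 ⟨blk n i, rfl⟩ with hb | hb <;> simp [hb]
    · simp [hij]
  rw [h]
  rfl

/-! ### Convergence of the joint moment functionals. -/

section Moments

variable {Ω U : Type*} [MeasurableSpace Ω] {P : Measure Ω}
  {blk : ∀ n : ℕ, Fin n → Fin 2} {V : U → Matrix (Fin 2) (Fin 2) ℝ}
  {Y : U → ∀ n : ℕ, Ω → Matrix (Fin n) (Fin n) ℂ}

theorem eventually_block_nonempty (hY : IsGaussianBlockEnsemble P blk V Y) (q : Fin 2) :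
    ∀ᶠ n in atTop, (Finset.univ.filter fun i => blk n i = q).card ≠ 0 := by
  have h0 := hY.nonempty
  have h1 := hY.dim₂.eventually_ne one_ne_zero
  fin_cases q
  · filter_upwards [h0] with n ⟨i, hi⟩
    exact Finset.card_ne_zero_of_mem (Finset.mem_filter.2 ⟨Finset.mem_univ i, hi⟩)
  · filter_upwards [h1] with n hn hc
    have hc' : (Finset.univ.filter fun i => blk n i = 1).card = 0 := hc
    exact hn (by rw [hc']; simp)

variable [IsProbabilityMeasure P]

theorem momentFunctional_eq (hY : IsGaussianBlockEnsemble P blk V Y) (α : U → Fin 2 → ℝ)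
    (q : Fin 2) (n : ℕ) (p : FreeAlgebra ℂ U) :
    momentFunctional P blk (meixnerMatrix blk α Y) q n p =
      ((Finset.univ.filter fun i => blk n i = q).card : ℂ)⁻¹ *
        ∑ i ∈ Finset.univ.filter (fun i => blk n i = q),
          entryExp hY n (FreeAlgebra.lift ℂ (polyMatrix (blk n) α) p i i) := by
  simp only [momentFunctional, partialTrace, lift_meixnerMatrix, entryExp_apply]

/-- Each diagonal entry with index in N_q has expectation close to the same limit, uniformly in the
index. Averaging preserves the bound, whatever the size of N_q, as long as it is nonempty. -/
theorem tendsto_momentFunctional_word (hY : IsGaussianBlockEnsemble P blk V Y)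
    (α : U → Fin 2 → ℝ) (hβ : ∀ u q, 0 ≤ V u 1 q) (q : Fin 2) (w : List U) :
    Tendsto (fun n => momentFunctional P blk (meixnerMatrix blk α Y) q n
      (w.map (FreeAlgebra.ι ℂ)).prod) atTop (𝓝 (vacMoment α (fun u => V u 1) q w)) := by
  rw [Metric.tendsto_nhds]
  intro ε hε
  filter_upwards [eventually_block_nonempty hY q, eventually_norm_segExp_sub_segLim_le hY α
    (vacMoment α fun u => V u 1) (fun q => vacMoment_nil α _ q)
    (fun q u w => vacMoment_cons α (fun u => V u 1) hβ q u w) [w] (half_pos hε)] with n hc hn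
  set s := Finset.univ.filter fun i => blk n i = q with hs
  set z := vacMoment α (fun u => V u 1) q w with hz
  have hc' : (s.card : ℂ) ≠ 0 := by exact_mod_cast hc
  have hterm : ∀ i, entryExp hY n (FreeAlgebra.lift ℂ (polyMatrix (blk n) α)
      (w.map (FreeAlgebra.ι ℂ)).prod i i) = segExp hY α n [(w, i, i)] := fun i => by
    rw [segExp, segPoly_cons, map_list_prod, List.map_map]
    simp only [segPoly, List.map_nil, List.prod_nil, mul_one, wordPoly, Function.comp_def,
      FreeAlgebra.lift_ι_apply]
  have hdiff : momentFunctional P blk (meixnerMatrix blk α Y) q n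
      (w.map (FreeAlgebra.ι ℂ)).prod - z =
      (s.card : ℂ)⁻¹ * ∑ i ∈ s, (segExp hY α n [(w, i, i)] - z) := by
    rw [momentFunctional_eq hY, Finset.sum_sub_distrib, Finset.sum_const, nsmul_eq_mul, mul_sub,
      inv_mul_cancel_left₀ hc']
    simp only [hterm, hs]
  rw [dist_eq_norm, hdiff, norm_mul, norm_inv, Complex.norm_natCast]
  have hle : ‖∑ i ∈ s, (segExp hY α n [(w, i, i)] - z)‖ ≤ s.card * (ε / 2) := by
    rw [← nsmul_eq_mul]
    refine (norm_sum_le _ _).trans (Finset.sum_le_card_nsmul s _ _ fun i hi => ?_)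
    have hi' : blk n i = q := (Finset.mem_filter.1 hi).2
    have := hn [(w, i, i)] rfl
    rwa [segLim_cons, segLim, List.map_nil, List.prod_nil, mul_one, entLim, if_pos rfl,
      hi'] at this
  have hc0 : (0 : ℝ) < s.card := by exact_mod_cast Nat.pos_of_ne_zero hc
  calc _ ≤ (s.card : ℝ)⁻¹ * (s.card * (ε / 2)) := by gcongr
    _ = ε / 2 := inv_mul_cancel_left₀ hc0.ne' _
    _ < ε := half_lt_self hε

/-- The limit of the joint moment functionals. -/
noncomputable def limitFunctional (α β : U → Fin 2 → ℝ) (q : Fin 2) : FreeAlgebra ℂ U →ₗ[ℂ] ℂ :=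
  vacState U q ∘ₗ (FreeAlgebra.lift ℂ (limitOp α β)).toLinearMap

theorem limitFunctional_apply (α β : U → Fin 2 → ℝ) (q : Fin 2) (p : FreeAlgebra ℂ U) :
    limitFunctional α β q p = vacState U q (FreeAlgebra.lift ℂ (limitOp α β) p) := rfl

theorem limitFunctional_word (α β : U → Fin 2 → ℝ) (q : Fin 2) (w : List U) :
    limitFunctional α β q (w.map (FreeAlgebra.ι ℂ)).prod = vacMoment α β q w := by
  rw [limitFunctional_apply, map_list_prod, List.map_map, vacMoment]
  simp only [Function.comp_def, FreeAlgebra.lift_ι_apply]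

/-- Words span the noncommutative polynomials, and both sides are linear. -/
theorem tendsto_momentFunctional (hY : IsGaussianBlockEnsemble P blk V Y)
    (α : U → Fin 2 → ℝ) (hβ : ∀ u q, 0 ≤ V u 1 q) (q : Fin 2) (p : FreeAlgebra ℂ U) :
    Tendsto (fun n => momentFunctional P blk (meixnerMatrix blk α Y) q n p) atTop
      (𝓝 (limitFunctional α (fun u => V u 1) q p)) := by
  have hp : p ∈ Subalgebra.toSubmodule
      (Algebra.adjoin ℂ (Set.range (FreeAlgebra.ι ℂ : U → FreeAlgebra ℂ U))) := by
    rw [FreeAlgebra.adjoin_range_ι]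
    exact Algebra.mem_top (R := ℂ)
  rw [Algebra.adjoin_eq_span] at hp
  induction hp using Submodule.span_induction with
  | mem x hx =>
    obtain ⟨l, hl, rfl⟩ := Submonoid.exists_list_of_mem_closure hx
    have : ∃ w : List U, l = w.map (FreeAlgebra.ι ℂ) := by
      have : l ∈ Set.range (List.map (FreeAlgebra.ι ℂ : U → FreeAlgebra ℂ U)) := by
        rw [Set.range_list_map]
        exact hl
      obtain ⟨w, hw⟩ := this
      exact ⟨w, hw.symm⟩
    obtain ⟨w, rfl⟩ := this
    rw [limitFunctional_word]
    exact tendsto_momentFunctional_word hY α hβ q w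
  | zero =>
    simp only [momentFunctional_eq hY, map_zero, Matrix.zero_apply, Finset.sum_const_zero,
      mul_zero]
    exact tendsto_const_nhds
  | add x y _ _ hx hy =>
    rw [map_add]
    refine (hx.add hy).congr fun n => ?_
    simp only [momentFunctional_eq hY, map_add, Matrix.add_apply, Finset.sum_add_distrib, mul_add]
  | smul c x _ hx =>
    rw [map_smul]
    refine (hx.const_smul c).congr fun n => ?_
    simp only [momentFunctional_eq hY, map_smul, Matrix.smul_apply, smul_eq_mul, Finset.mul_sum]
    exact Finset.sum_congr rfl fun i _ => by ring

/-- Conditional freeness pulls back along the homomorphism sending each X_u to y(u), because y(u)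
lies in 𝒜(u). -/
theorem condFree_limitFunctional (α β : U → Fin 2 → ℝ) (hβ : ∀ u, 0 < β u 0) :
    CondFree (limitFunctional α β 0) (limitFunctional α β 1)
      (fun u => Algebra.adjoin ℂ {FreeAlgebra.ι ℂ u}) := by
  intro k u a ha hu hψ hφ
  have hmem : ∀ i, FreeAlgebra.lift ℂ (limitOp α β) (a i) ∈ fockAlgebra β (u i) := fun i => by
    have hle : Algebra.adjoin ℂ {FreeAlgebra.ι ℂ (u i)} ≤
        (fockAlgebra β (u i)).comap (FreeAlgebra.lift ℂ (limitOp α β)) := by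
      rw [Algebra.adjoin_le_iff, Set.singleton_subset_iff, SetLike.mem_coe, Subalgebra.mem_comap,
        FreeAlgebra.lift_ι_apply]
      exact limitOp_mem_fockAlgebra α β (u i) (hβ (u i))
    exact hle (ha i)
  have h := condFree_fockAlgebra β k u _ hmem hu hψ hφ
  rwa [limitFunctional_apply, map_list_prod, List.map_ofFn]

end Moments

end FreeMeixner

theorem theorem5p1 {Ω U : Type*} [MeasurableSpace Ω] (P : MeasureTheory.Measure Ω)
    [MeasureTheory.IsProbabilityMeasure P]
    (blk : ∀ n : ℕ, Fin n → Fin 2)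
    (V : U → Matrix (Fin 2) (Fin 2) ℝ) (α : U → Fin 2 → ℝ)
    (Y : U → ∀ n : ℕ, Ω → Matrix (Fin n) (Fin n) ℂ)
    (hY : FreeMeixner.IsGaussianBlockEnsemble P blk V Y)
    -- `β₁(u) = v_{2,1}(u) > 0` and `β₂(u) = v_{2,2}(u) ≥ 0`
    (hβ₁ : ∀ u, 0 < V u 1 0) (hβ₂ : ∀ u, 0 ≤ V u 1 1) :
    -- asymptotic conditional freeness of the `M(u,n)` with respect to `(τ₁(n), τ₂(n))`
    FreeMeixner.AsympCondFree
      (FreeMeixner.momentFunctional P blk (FreeMeixner.meixnerMatrix blk α Y) 0)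
      (FreeMeixner.momentFunctional P blk (FreeMeixner.meixnerMatrix blk α Y) 1) ∧
    -- convergence of the mixed moments to those of the operators `y(u)` in the vacuum states
    (∀ (q : Fin 2) (m : ℕ) (u : Fin m → U),
      Filter.Tendsto
        (fun n => FreeMeixner.partialTrace P (blk n) q
          fun ω => (List.ofFn fun i => FreeMeixner.meixnerMatrix blk α Y (u i) n ω).prod)
        Filter.atTop
        (nhds (FreeMeixner.vacState U q
          (List.ofFn fun i => FreeMeixner.limitOp α (fun u => V u 1) (u i)).prod))) ∧
    -- conditional freeness of the unital *-algebras generated by `℘₁(u)`, `℘₂(u)`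
    FreeMeixner.CondFree (FreeMeixner.vacState U 0) (FreeMeixner.vacState U 1)
      (FreeMeixner.fockAlgebra fun u => V u 1) := by
  have hβ : ∀ u q, 0 ≤ V u 1 q := fun u => Fin.forall_fin_two.2 ⟨(hβ₁ u).le, hβ₂ u⟩
  refine ⟨⟨FreeMeixner.limitFunctional α (fun u => V u 1) 0,
    FreeMeixner.limitFunctional α (fun u => V u 1) 1,
    FreeMeixner.tendsto_momentFunctional hY α hβ 0, FreeMeixner.tendsto_momentFunctional hY α hβ 1,
    FreeMeixner.condFree_limitFunctional α _ hβ₁⟩, fun q m u => ?_,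
    FreeMeixner.condFree_fockAlgebra _⟩
  have h := FreeMeixner.tendsto_momentFunctional_word hY α hβ q (List.ofFn u)
  simp only [FreeMeixner.momentFunctional, map_list_prod, Function.comp_def,
    FreeAlgebra.lift_ι_apply, FreeMeixner.vacMoment, List.map_ofFn] at h
  exact h
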